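/- **Theorem.** Let $m\ge 1$, let $d_k\ge 2$ and $1\le r_k\le d_k$ ($k=1,\dots,m$) be integers with $r_k\le\prod_{j\ne k}r_j$ for every $k$ (for $r_k\le d_k$, this says precisely that tensors of Tucker rank exactly $\mathbf r=(r_1,\dots,r_m)$ exist), and let $\mu^*\ge 1$, $\sigma>0$, $\alpha\in(0,1)$. Put $d^*=\prod_k d_k$, $r^*=\prod_k r_k$ and $\mathrm{DoF}_m=r^*+\sum_{k=1}^m d_kr_k$. Let $\mathbb M_{\mathbf r,\mu^*}$ be the set of tensors $\mathcal T\in\mathbb R^{d_1\times\cdots\times d_m}$ whose mode-$k$ matricization has rank at most $r_k$ for each $k$, and which have a Tucker decomposition $\mathcal T=\mathcal C\times_1U_1\times_2\cdots\times_mU_m$ with $\mathcal C\in\mathbb R^{r_1\times\cdots\times r_m}$ and $U_k\in\mathbb R^{d_k\times r_k}$ having orthonormal columns and satisfying $\max_i\|e_i^\top U_k\|^2\, d_k/r_k\le\mu^*$ for every $k$. One observes $\mathcal Y=\mathcal T^*+\Xi+\mathcal S$ with $\mathcal T^*\in\mathbb M_{\mathbf r,\mu^*}$, where the pairs $(\Xi_\omega,\mathcal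 S_\omega)$, $\omega\in[d_1]\times\cdots\times[d_m]$, are independent, $\Xi_\omega\sim N(0,\sigma^2)$, and $\mathcal S$ is a Huber contamination of rate $\alpha$: independently of the noise, entry $\omega$ is left uncontaminated ($\mathcal S_\omega=0$) with probability $1-\alpha$; with probability $\alpha$ it is contaminated, and then $\mathcal S_\omega$ has an arbitrary law $Q_\omega$ and may be coupled arbitrarily with $\Xi_\omega$. Thus $\mathcal S_\omega\sim(1-\alpha)\delta_0+\alpha Q_\omega$, and $\mathcal Y_\omega\sim(1-\alpha)N(\mathcal T^*_\omega,\sigma^2)+\alpha\widetilde Q_\omega$ with $\widetilde Q_\omega$ arbitrary. Then there are absolute constants $c,C>0$ (not depending on $m$, the $d_k$, the $r_k$, $\mu^*$, $\sigma$ or $\alpha$) such that $$\inf_{\widehat{\mathcal T}}\ \sup_{\mathcal T^*\in\mathbb M_{\mathbf r,\mu^*}}\ \sup_{\text{contaminations}}\ \mathbb P\Big(\|\widehat{\mathcal T}(\mathcal Y)-\mathcal T^*\|_F^2\ \ge\ C\,\sigma^2\max\Big\{\mathrm{DoF}_m,\ \frac{\alpha^2d^*}{(\mu^*)^m r^*}\Big\}\Big)\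 \ge\ c,$$ where the infimum is over all measurable maps $\widehat{\mathcal T}:\mathbb R^{d_1\times\cdots\times d_m}\to\mathbb R^{d_1\times\cdots\times d_m}$, and the supremum over contaminations is over all choices, for every $\omega$, of $Q_\omega$ and of its coupling with the noise $\Xi_\omega$. -/

import Mathlib

open MeasureTheory ProbabilityTheory
open scoped ENNReal

noncomputable section

namespace RobustTensor

/-- Multi-indices `[d₁] × ⋯ × [dₘ]`. -/
abbrev Idx {m : ℕ} (d : Fin m → ℕ) : Type := (k : Fin m) → Fin (d k)

/-- Real tensors of order `m` and size `d₁ × ⋯ × dₘ`, with the product σ-algebra. -/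
abbrev Tensor {m : ℕ} (d : Fin m → ℕ) : Type := Idx d → ℝ

/-- The squared Frobenius norm `‖T‖_F²`. -/
def frobSq {m : ℕ} {d : Fin m → ℕ} (T : Tensor d) : ℝ := ∑ w, T w ^ 2

/-- The mode-`k` matricization, of size `d_k × ∏_{j ≠ k} d_j`. -/
def matricization {m : ℕ} {d : Fin m → ℕ} (k : Fin m) (T : Tensor d) :
    Matrix (Fin (d k)) ((j : {j : Fin m // j ≠ k}) → Fin (d j)) ℝ :=
  Matrix.of fun i w => T ((Equiv.piSplitAt k fun j => Fin (d j)).symm (i, w))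

/-- The set `𝕄_r` of tensors whose Tucker rank is bounded by `r`. -/
def boundedTuckerRank {m : ℕ} (d r : Fin m → ℕ) : Set (Tensor d) :=
  {T | ∀ k, (matricization k T).rank ≤ r k}

/-- The Tucker product `C ×₁ U₁ ×₂ ⋯ ×ₘ Uₘ` of a core tensor with factor matrices. -/
def tucker {m : ℕ} {d r : Fin m → ℕ} (C : Tensor r)
    (U : (k : Fin m) → Matrix (Fin (d k)) (Fin (r k)) ℝ) : Tensor d :=
  fun w => ∑ l : Idx r, C l * ∏ k, U k (w k) (l k)

/-- `T` is `μ`-incoherent (at Tucker size `r`): it has a Tucker decomposition whose factors `U_k`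
of size `d_k × r_k` have orthonormal columns and satisfy `‖U_k‖²_{2,∞} · d_k / r_k ≤ μ`. If `T` has
Tucker rank exactly `r`, the row norms of `U_k` do not depend on the decomposition. -/
def Incoherent {m : ℕ} {d : Fin m → ℕ} (r : Fin m → ℕ) (μ : ℝ) (T : Tensor d) : Prop :=
  ∃ (C : Tensor r) (U : (k : Fin m) → Matrix (Fin (d k)) (Fin (r k)) ℝ),
    T = tucker C U ∧ ∀ k, (U k).transpose * U k = 1 ∧
      ∀ i, (∑ l, U k i l ^ 2) * (d k : ℝ) / (r k : ℝ) ≤ μ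

/-- The set `𝕄_{r,μ}` of `μ`-incoherent tensors of Tucker rank at most `r`. -/
def incoherentTensors {m : ℕ} (d r : Fin m → ℕ) (μ : ℝ) : Set (Tensor d) :=
  {T | T ∈ boundedTuckerRank d r ∧ Incoherent r μ T}

/-- `DoF_m = r₁ ⋯ rₘ + ∑ₖ dₖ rₖ`. -/
def DoF {m : ℕ} (d r : Fin m → ℕ) : ℕ := ∏ k, r k + ∑ k, d k * r k

/-- The noise distribution `N(0, σ²)`. -/
def noiseLaw (σ : ℝ) : Measure ℝ := gaussianReal 0 (σ ^ 2).toNNReal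

/-- An adversary's choice at one entry: the joint law `κ` of (noise, corruption) given that the
entry is contaminated. The noise is still `N(0, σ²)`; the corruption has an arbitrary law (the
second marginal of `κ`, called `Q_ω`) and may be coupled with the noise of that entry, so that the
value observed at a contaminated entry is arbitrary. -/
structure Corruption (σ : ℝ) where
  joint : Measure (ℝ × ℝ)
  isProb : IsProbabilityMeasure joint
  noise_marginal : joint.fst = noiseLaw σ

/-- The joint law of (noise, corruption) at one entry. With probability `1 - α` the corruption is
`0`, with probability `α` the entry is contaminated, independently of its noise. Thus the
noise is `N(0, σ²)` and the corruption has law `(1 - α) δ₀ + α Q_ω`. -/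
def entryLaw (σ α : ℝ) (κ : Corruption σ) : Measure (ℝ × ℝ) :=
  ENNReal.ofReal (1 - α) • ((noiseLaw σ).prod (Measure.dirac 0)) + ENNReal.ofReal α • κ.joint

/-- The joint law of the pair (noise tensor `Ξ`, corruption tensor `S`): independent over entries. -/
def noiseCorruptionLaw {m : ℕ} {d : Fin m → ℕ} (σ α : ℝ) (κ : Idx d → Corruption σ) :
    Measure (Idx d → ℝ × ℝ) :=
  Measure.pi fun w => entryLaw σ α (κ w)

/-- The observation `Y = T + Ξ + S`. -/
def observe {m : ℕ} {d : Fin m → ℕ} (T : Tensor d) (x : Idx d → ℝ × ℝ) : Tensor d :=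
  fun w => T w + (x w).1 + (x w).2

/-- The probability that the estimator `That`, applied to `Y = T + Ξ + S`, has squared Frobenius
error at least `t`. -/
def errorProb {m : ℕ} {d : Fin m → ℕ} (σ α : ℝ) (κ : Idx d → Corruption σ)
    (That : Tensor d → Tensor d) (T : Tensor d) (t : ℝ) : ℝ≥0∞ :=
  noiseCorruptionLaw σ α κ {x | t ≤ frobSq (That (observe T x) - T)}

end RobustTensor

end

/-!
Both terms of the maximum are lower bounds on their own, and an error level that is a lower bound
remains one when it is decreased, so each contribution to the rate is treated by a family of
tensors of its own (`HasRisk`). All families are built from *equal norm tight frames*: matrices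
`U` of size `d × r` with orthonormal columns and all rows of squared norm `r / d`. They exist in all
sizes (`exists_isEqualNormFrame`), and every Tucker product with such factors is incoherent even for
`μ = 1` (`sum_colTensor_mem`).

*Contamination.* A unit rank-one tensor formed by columns of such frames has entries of square at
most `r* / d*`. Its multiple of squared norm `α² σ² d* / (2 r*)` therefore has entries at most
`α σ / √2`, and `N(0, σ²)` and `N(a, σ²)` with `|a| ≤ α σ / √2` have total variation distance at
most `α`. Hence the adversary can give the observations of this tensor and of `0` exactly the same
law (`exists_common_law`), and every estimator fails for one of the two.

*Degrees of freedom.* Here the adversary is idle. A Bayesian argument with second moments of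
Gaussian likelihood ratios (`exists_gaussPi_le`) shows that an error of squared size `t` is
unavoidable for a finite family which lies in a ball of squared radius `σ² b` and of which no ball
of squared radius `t` contains more than a fraction `exp (-2 b)`. In particular this holds for cubes
`{0,1}^N` whose squared distances are comparable to `σ²` times the Hamming distance, with `t` of
order `σ² N`. The degrees of freedom split into four parts, and the largest one is used:

* `r*`, together with the modes with `d_k < 2 r_k`, which contribute `O(r*)` because
  `r_k ≤ ∏_{j ≠ k} r_j`: the factors are fixed and the core runs through a cube (`hasRisk_core`).
* The modes with `r_k ≤ 2` and `2 r_k ≤ d_k`: a rank-one tensor with independent sign flips in all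
  coordinates of its factors. The normalized inner product of two such tensors is a product of
  averages of signs, and Hoeffding's inequality in each mode bounds the probability that it is
  close to `1` (`hasRisk_signs`).
* A single mode with `3 ≤ r_k` and `2 r_k ≤ d_k`, and all such modes except the one of largest rank
  (`hasRisk_factor`, `hasRisk_factors_erase`). In each of these modes there is a cube of dimension
  of order `d_k r_k` of equal norm tight frames with a common column `0`, obtained by filling most
  rows with scaled orthogonal matrices, namely Cayley transforms of small skew-symmetric matrices
  (`exists_isFrameCube`). The core is chosen so that each of its entries involves a column other
  than `0` in at most one varying mode. Then the tensor is a sum of terms each of which depends on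
  one varying factor only, the changes of these terms are orthogonal, and the cubes of the different
  modes combine to one cube (`hasRisk_factors`), with constants independent of the number of modes.
-/

open scoped NNReal

noncomputable section

namespace RobustTensor

/-! ### Gaussian shifts: likelihood ratios and their second moments -/

section Gaussian

variable {ι : Type*} [Fintype ι]

lemma lintegral_pi_prod {X : ι → Type*} [∀ i, MeasurableSpace (X i)] (P : (i : ι) → Measure (X i))
    [∀ i, IsProbabilityMeasure (P i)] {f : (i : ι) → X i → ℝ≥0∞} (hf : ∀ i, Measurable (f i)) :
    ∫⁻ x, ∏ i, f i (x i) ∂(Measure.pi P) = ∏ i, ∫⁻ y, f i y ∂(P i) := by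
  have hind := iIndepFun_pi (μ := P) (X := f) fun i => (hf i).aemeasurable
  have h := lintegral_prod_eq_prod_lintegral_of_indepFun Finset.univ
    (fun i (x : (i : ι) → X i) => f i (x i)) hind
    (fun i => (hf i).comp (measurable_pi_apply i))
  rw [h]
  refine Finset.prod_congr rfl fun i _ => ?_
  exact (measurePreserving_eval P i).lintegral_comp (hf i)

/-- A product of measures with densities has the product of the densities as its density. -/
lemma pi_withDensity {X : ι → Type*} [∀ i, MeasurableSpace (X i)] (P : (i : ι) → Measure (X i))
    [∀ i, IsProbabilityMeasure (P i)] {f : (i : ι) → X i → ℝ≥0∞} (hf : ∀ i, Measurable (f i))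
    [∀ i, IsProbabilityMeasure ((P i).withDensity (f i))] :
    Measure.pi (fun i => (P i).withDensity (f i)) =
      (Measure.pi P).withDensity fun x => ∏ i, f i (x i) := by
  refine Measure.pi_eq fun s hs => ?_
  rw [withDensity_apply _ (MeasurableSet.univ_pi hs), ← lintegral_indicator (MeasurableSet.univ_pi hs)]
  have : (fun x : (i : ι) → X i => (Set.univ.pi s).indicator (fun x => ∏ i, f i (x i)) x) =
      fun x => ∏ i, (s i).indicator (f i) (x i) := by
    funext x
    by_cases hx : x ∈ Set.univ.pi s
    · rw [Set.indicator_of_mem hx]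
      exact Finset.prod_congr rfl fun i _ => (Set.indicator_of_mem (hx i trivial) _).symm
    · rw [Set.indicator_of_notMem hx]
      simp only [Set.mem_pi, not_forall] at hx
      obtain ⟨i, _, hi⟩ := hx
      exact (Finset.prod_eq_zero (Finset.mem_univ i) (Set.indicator_of_notMem hi _)).symm
  rw [this, lintegral_pi_prod P fun i => (hf i).indicator (hs i)]
  refine Finset.prod_congr rfl fun i _ => ?_
  rw [lintegral_indicator (hs i), withDensity_apply _ (hs i)]

/-- The likelihood ratio of `N(a + h, v)` with respect to `N(a, v)`. -/
def gaussLR (a : ℝ) (v : ℝ≥0) (h x : ℝ) : ℝ :=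
  Real.exp (h * (x - a) / v - h ^ 2 / (2 * v))

lemma gaussLR_nonneg (a : ℝ) (v : ℝ≥0) (h x : ℝ) : 0 ≤ gaussLR a v h x := (Real.exp_pos _).le

lemma measurable_gaussLR (a : ℝ) (v : ℝ≥0) (h : ℝ) : Measurable (gaussLR a v h) := by
  unfold gaussLR; fun_prop

lemma gaussianPDFReal_shift (a : ℝ) {v : ℝ≥0} (hv : v ≠ 0) (h x : ℝ) :
    gaussianPDFReal (a + h) v x = gaussianPDFReal a v x * gaussLR a v h x := by
  have hv' : (v : ℝ) ≠ 0 := by exact_mod_cast hv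
  simp only [gaussianPDFReal, gaussLR]
  rw [mul_assoc (√_)⁻¹, ← Real.exp_add]
  congr 2
  field_simp
  ring

lemma gaussianReal_shift (a : ℝ) {v : ℝ≥0} (hv : v ≠ 0) (h : ℝ) :
    gaussianReal (a + h) v =
      (gaussianReal a v).withDensity fun x => ENNReal.ofReal (gaussLR a v h x) := by
  rw [gaussianReal_of_var_ne_zero _ hv, gaussianReal_of_var_ne_zero _ hv,
    ← withDensity_mul _ (measurable_gaussianPDF _ _) (measurable_gaussLR a v h).ennreal_ofReal]
  congr 1
  funext x
  simp only [Pi.mul_apply, gaussianPDF]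
  rw [gaussianPDFReal_shift a hv, ENNReal.ofReal_mul (gaussianPDFReal_nonneg _ _ _)]

lemma lintegral_gaussLR (a : ℝ) {v : ℝ≥0} (hv : v ≠ 0) (h : ℝ) :
    ∫⁻ x, ENNReal.ofReal (gaussLR a v h x) ∂(gaussianReal a v) = 1 := by
  have := measure_univ (μ := gaussianReal (a + h) v)
  rwa [gaussianReal_shift a hv, withDensity_apply _ MeasurableSet.univ, setLIntegral_univ] at this

/-- Completing the square: the squared likelihood ratio at shift `h` is, up to a constant, the
likelihood ratio at shift `2h`. -/
lemma gaussLR_sq (a : ℝ) {v : ℝ≥0} (hv : v ≠ 0) (h x : ℝ) :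
    gaussLR a v h x ^ 2 = Real.exp (h ^ 2 / v) * gaussLR a v (2 * h) x := by
  have hv' : (v : ℝ) ≠ 0 := by exact_mod_cast hv
  simp only [gaussLR]
  rw [← Real.exp_nat_mul, ← Real.exp_add]
  congr 1
  push_cast
  field_simp
  ring

lemma lintegral_gaussLR_sq (a : ℝ) {v : ℝ≥0} (hv : v ≠ 0) (h : ℝ) :
    ∫⁻ x, ENNReal.ofReal (gaussLR a v h x) ^ 2 ∂(gaussianReal a v) =
      ENNReal.ofReal (Real.exp (h ^ 2 / v)) := by
  have : ∀ x, ENNReal.ofReal (gaussLR a v h x) ^ 2 =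
      ENNReal.ofReal (Real.exp (h ^ 2 / v)) * ENNReal.ofReal (gaussLR a v (2 * h) x) := fun x => by
    rw [← ENNReal.ofReal_pow (gaussLR_nonneg _ _ _ _), gaussLR_sq a hv,
      ENNReal.ofReal_mul (Real.exp_pos _).le]
  simp_rw [this]
  rw [lintegral_const_mul _ (measurable_gaussLR a v _).ennreal_ofReal, lintegral_gaussLR a hv,
    mul_one]

/-- The law of a vector of independent Gaussians with mean `θ` and common variance `v`. -/
def gaussPi (θ : ι → ℝ) (v : ℝ≥0) : Measure (ι → ℝ) := Measure.pi fun i => gaussianReal (θ i) v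

instance (θ : ι → ℝ) (v : ℝ≥0) : IsProbabilityMeasure (gaussPi θ v) := by
  unfold gaussPi; infer_instance

/-- Change of measure between two Gaussian laws: the inequality `L ≤ s / 2 + L² / (2 s)` for the
likelihood ratio `L` replaces the Cauchy–Schwarz inequality. -/
lemma gaussPi_le (θ₀ θ : ι → ℝ) {v : ℝ≥0} (hv : v ≠ 0) {A : Set (ι → ℝ)} (hA : MeasurableSet A)
    {s : ℝ} (hs : 0 < s) :
    gaussPi θ v A ≤ ENNReal.ofReal (s / 2) * gaussPi θ₀ v A +
      ENNReal.ofReal (Real.exp ((∑ i, (θ i - θ₀ i) ^ 2) / v) / (2 * s)) := by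
  set L : (ι → ℝ) → ℝ := fun x => ∏ i, gaussLR (θ₀ i) v (θ i - θ₀ i) (x i) with hL
  have hL0 : ∀ x, 0 ≤ L x := fun x => Finset.prod_nonneg fun i _ => gaussLR_nonneg _ _ _ _
  have hLm : Measurable L := Finset.measurable_prod _ fun i _ =>
    (measurable_gaussLR _ _ _).comp (measurable_pi_apply i)
  have hshift : ∀ i, gaussianReal (θ i) v = (gaussianReal (θ₀ i) v).withDensity
      fun x => ENNReal.ofReal (gaussLR (θ₀ i) v (θ i - θ₀ i) x) := fun i => by
    rw [← gaussianReal_shift _ hv]; congr 1; ring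
  have hP : gaussPi θ v = (gaussPi θ₀ v).withDensity fun x => ENNReal.ofReal (L x) := by
    unfold gaussPi
    simp_rw [hshift]
    have : ∀ i, IsProbabilityMeasure ((gaussianReal (θ₀ i) v).withDensity
      fun x => ENNReal.ofReal (gaussLR (θ₀ i) v (θ i - θ₀ i) x)) := fun i => by
        rw [← hshift i]; infer_instance
    rw [pi_withDensity _ fun i => (measurable_gaussLR _ _ _).ennreal_ofReal]
    congr 1
    funext x
    rw [hL, ENNReal.ofReal_prod_of_nonneg fun i _ => gaussLR_nonneg _ _ _ _]
  have hsq : ∫⁻ x, ENNReal.ofReal (L x) ^ 2 ∂(gaussPi θ₀ v) =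
      ENNReal.ofReal (Real.exp ((∑ i, (θ i - θ₀ i) ^ 2) / v)) := by
    have : ∀ x, ENNReal.ofReal (L x) ^ 2 =
        ∏ i, ENNReal.ofReal (gaussLR (θ₀ i) v (θ i - θ₀ i) (x i)) ^ 2 := fun x => by
      rw [hL, ENNReal.ofReal_prod_of_nonneg fun i _ => gaussLR_nonneg _ _ _ _, Finset.prod_pow]
    simp_rw [this]
    unfold gaussPi
    rw [lintegral_pi_prod _ fun i => (measurable_gaussLR _ _ _).ennreal_ofReal.pow_const 2]
    simp_rw [lintegral_gaussLR_sq _ hv]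
    rw [← ENNReal.ofReal_prod_of_nonneg fun i _ => (Real.exp_pos _).le, ← Real.exp_sum,
      Finset.sum_div]
  have hpt : ∀ x, ENNReal.ofReal (L x) ≤
      ENNReal.ofReal (s / 2) + ENNReal.ofReal (1 / (2 * s)) * ENNReal.ofReal (L x) ^ 2 := fun x => by
    rw [← ENNReal.ofReal_pow (hL0 x), ← ENNReal.ofReal_mul (by positivity),
      ← ENNReal.ofReal_add (by positivity) (by positivity)]
    apply ENNReal.ofReal_le_ofReal
    have : s / 2 + 1 / (2 * s) * L x ^ 2 - L x = (L x - s) ^ 2 / (2 * s) := by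
      field_simp; ring
    have h2 : 0 ≤ (L x - s) ^ 2 / (2 * s) := by positivity
    linarith
  calc gaussPi θ v A = ∫⁻ x in A, ENNReal.ofReal (L x) ∂(gaussPi θ₀ v) := by
        rw [hP, withDensity_apply _ hA]
    _ ≤ ∫⁻ x in A, (ENNReal.ofReal (s / 2) +
          ENNReal.ofReal (1 / (2 * s)) * ENNReal.ofReal (L x) ^ 2) ∂(gaussPi θ₀ v) :=
        lintegral_mono hpt
    _ = ENNReal.ofReal (s / 2) * gaussPi θ₀ v A +
          ENNReal.ofReal (1 / (2 * s)) * ∫⁻ x in A, ENNReal.ofReal (L x) ^ 2 ∂(gaussPi θ₀ v) := by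
        rw [lintegral_add_left measurable_const, setLIntegral_const,
          lintegral_const_mul _ (hLm.ennreal_ofReal.pow_const 2)]
    _ ≤ _ := by
        gcongr
        refine (mul_le_mul_right (setLIntegral_le_lintegral _ _) _).trans ?_
        rw [hsq, ← ENNReal.ofReal_mul (by positivity)]
        apply ENNReal.ofReal_le_ofReal
        rw [one_div_mul_eq_div]

/-- A Bayesian lower bound for Gaussian location models: if the hypotheses `θ j` are close to a
centre `θ₀`, while no event family `A j` covers a point for more than a small fraction of the
hypotheses, then some hypothesis gives its own event probability bounded away from `1`. -/
lemma exists_gaussPi_le {J : Type*} [Fintype J] [Nonempty J] (θ₀ : ι → ℝ) (θ : J → ι → ℝ)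
    {v : ℝ≥0} (hv : v ≠ 0) {b : ℝ} (hb : ∀ j, ∑ i, (θ j i - θ₀ i) ^ 2 ≤ v * b)
    (A : J → Set (ι → ℝ)) (hA : ∀ j, MeasurableSet (A j))
    (hcov : ∀ y, ∑ j, (A j).indicator (fun _ => (1 : ℝ)) y ≤
      Real.exp (-2 * b) * Fintype.card J) :
    ∃ j, gaussPi (θ j) v (A j) ≤ ENNReal.ofReal (Real.exp (-b / 2)) := by
  by_contra! hcon
  have hv0 : (0 : ℝ) < v := by
    have : 0 < v := pos_iff_ne_zero.mpr hv
    exact_mod_cast this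
  have hJ : (0 : ℝ) < Fintype.card J := by exact_mod_cast Fintype.card_pos
  -- the value of `s` that balances the two terms of `gaussPi_le`
  set s := Real.exp (3 * b / 2) with hs
  have hspos : 0 < s := Real.exp_pos _
  have hsum : ∑ j, gaussPi θ₀ v (A j) ≤ ENNReal.ofReal (Real.exp (-2 * b) * Fintype.card J) := by
    calc ∑ j, gaussPi θ₀ v (A j)
        = ∑ j, ∫⁻ y, (A j).indicator (fun _ => 1) y ∂(gaussPi θ₀ v) := by
          refine Finset.sum_congr rfl fun j _ => ?_
          rw [lintegral_indicator (hA j), setLIntegral_const, one_mul]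
      _ = ∫⁻ y, ∑ j, (A j).indicator (fun _ => 1) y ∂(gaussPi θ₀ v) := by
          rw [lintegral_finsetSum _ fun j _ => measurable_const.indicator (hA j)]
      _ ≤ ∫⁻ _, ENNReal.ofReal (Real.exp (-2 * b) * Fintype.card J) ∂(gaussPi θ₀ v) := by
          refine lintegral_mono fun y => ?_
          refine le_trans (le_of_eq ?_) (ENNReal.ofReal_le_ofReal (hcov y))
          rw [ENNReal.ofReal_sum_of_nonneg fun j _ => Set.indicator_nonneg (by simp) _]
          refine Finset.sum_congr rfl fun j _ => ?_
          by_cases h : y ∈ A j <;> simp [h]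
      _ = _ := by simp
  have hj : ∀ j, gaussPi (θ j) v (A j) ≤ ENNReal.ofReal (s / 2) * gaussPi θ₀ v (A j) +
      ENNReal.ofReal (Real.exp b / (2 * s)) := fun j => by
    refine (gaussPi_le θ₀ (θ j) hv (hA j) hspos).trans ?_
    gcongr
    rw [div_le_iff₀ hv0, mul_comm]
    exact hb j
  have h1 : ∑ j : J, ENNReal.ofReal (Real.exp (-b / 2)) < ∑ j, gaussPi (θ j) v (A j) :=
    ENNReal.sum_lt_sum_of_nonempty Finset.univ_nonempty fun j _ => hcon j
  have h2 : ∑ j, gaussPi (θ j) v (A j) ≤ ENNReal.ofReal (Real.exp (-b / 2) * Fintype.card J) := by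
    calc ∑ j, gaussPi (θ j) v (A j) ≤ ∑ j, (ENNReal.ofReal (s / 2) * gaussPi θ₀ v (A j) +
          ENNReal.ofReal (Real.exp b / (2 * s))) := Finset.sum_le_sum fun j _ => hj j
      _ = ENNReal.ofReal (s / 2) * ∑ j, gaussPi θ₀ v (A j) +
          Fintype.card J * ENNReal.ofReal (Real.exp b / (2 * s)) := by
          rw [Finset.sum_add_distrib, Finset.mul_sum, Finset.sum_const, Finset.card_univ,
            nsmul_eq_mul]
      _ ≤ ENNReal.ofReal (s / 2) * ENNReal.ofReal (Real.exp (-2 * b) * Fintype.card J) +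
          ENNReal.ofReal (Fintype.card J) * ENNReal.ofReal (Real.exp b / (2 * s)) := by
          rw [ENNReal.ofReal_natCast]; gcongr
      _ = _ := by
          rw [← ENNReal.ofReal_mul (by positivity), ← ENNReal.ofReal_mul (by positivity),
            ← ENNReal.ofReal_add (by positivity) (by positivity)]
          congr 1
          have e1 : s * Real.exp (-2 * b) = Real.exp (-b / 2) := by
            rw [hs, ← Real.exp_add]; congr 1; ring
          have e2 : Real.exp b / s = Real.exp (-b / 2) := by
            rw [hs, ← Real.exp_sub]; congr 1; ring
          calc _ = (s * Real.exp (-2 * b)) * Fintype.card J / 2 +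
                (Real.exp b / s) * Fintype.card J / 2 := by field_simp
            _ = _ := by rw [e1, e2]; ring
  refine absurd (h1.trans_le h2) (not_lt.mpr ?_)
  rw [Finset.sum_const, Finset.card_univ, nsmul_eq_mul, mul_comm (Real.exp _),
    ENNReal.ofReal_mul (by positivity), ENNReal.ofReal_natCast]

end Gaussian

/-! ### The law of one observed entry -/

/-- The law of the observation `t + ξ + s` at an entry with mean `t`. -/
def obsLaw (σ α t : ℝ) (κ : Corruption σ) : Measure ℝ :=
  (entryLaw σ α κ).map fun p => t + p.1 + p.2

instance (σ : ℝ) : IsProbabilityMeasure (noiseLaw σ) := by unfold noiseLaw; infer_instance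

lemma isProbabilityMeasure_convex {X : Type*} [MeasurableSpace X] {α : ℝ} (h0 : 0 ≤ α) (h1 : α ≤ 1)
    (P Q : Measure X) [IsProbabilityMeasure P] [IsProbabilityMeasure Q] :
    IsProbabilityMeasure (ENNReal.ofReal (1 - α) • P + ENNReal.ofReal α • Q) := by
  constructor
  simp only [Measure.add_apply, Measure.smul_apply, measure_univ, smul_eq_mul, mul_one]
  rw [← ENNReal.ofReal_add (by linarith) h0]
  simp

lemma errorProb_eq {m : ℕ} {d : Fin m → ℕ} {σ α : ℝ} (h0 : 0 ≤ α) (h1 : α ≤ 1)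
    (κ : Idx d → Corruption σ) {That : Tensor d → Tensor d} (hT : Measurable That) (T : Tensor d)
    (t : ℝ) :
    errorProb σ α κ That T t =
      Measure.pi (fun w => obsLaw σ α (T w) (κ w)) {y | t ≤ frobSq (That y - T)} := by
  have hm : MeasurableSet {y | t ≤ frobSq (That y - T)} := by
    refine measurableSet_le measurable_const ?_
    unfold frobSq
    refine Finset.measurable_sum _ fun w _ => ?_
    exact (((measurable_pi_apply w).comp hT).sub measurable_const).pow_const 2
  have hp : ∀ w, IsProbabilityMeasure (entryLaw σ α (κ w)) := fun w => by
    have := (κ w).isProb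
    exact isProbabilityMeasure_convex h0 h1 _ _
  have hf : ∀ w, Measurable fun p : ℝ × ℝ => T w + p.1 + p.2 := fun w => by fun_prop
  have hp' : ∀ w, IsProbabilityMeasure ((entryLaw σ α (κ w)).map fun p => T w + p.1 + p.2) :=
    fun w => Measure.isProbabilityMeasure_map (hf w).aemeasurable
  unfold errorProb obsLaw noiseCorruptionLaw
  rw [← Measure.pi_map_pi fun w => (hf w).aemeasurable, Measure.map_apply _ hm]
  · rfl
  · exact measurable_pi_lambda _ fun w => (hf w).comp (measurable_pi_apply w)

lemma noiseLaw_map (σ t : ℝ) :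
    (noiseLaw σ).map (fun x => t + x) = gaussianReal t (σ ^ 2).toNNReal := by
  unfold noiseLaw
  rw [gaussianReal_map_const_add]
  simp

/-- The adversary who does nothing: a contaminated entry receives the corruption `0`. -/
def idle (σ : ℝ) : Corruption σ where
  joint := (noiseLaw σ).prod (Measure.dirac 0)
  isProb := inferInstance
  noise_marginal := Measure.fst_prod

lemma map_prod_dirac_zero (σ t : ℝ) :
    ((noiseLaw σ).prod (Measure.dirac 0)).map (fun p : ℝ × ℝ => t + p.1 + p.2) =
      gaussianReal t (σ ^ 2).toNNReal := by
  rw [Measure.prod_dirac, Measure.map_map (by fun_prop) (by fun_prop), ← noiseLaw_map]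
  congr 1
  funext x
  simp

lemma obsLaw_idle {σ α : ℝ} (h0 : 0 ≤ α) (h1 : α ≤ 1) (t : ℝ) :
    obsLaw σ α t (idle σ) = gaussianReal t (σ ^ 2).toNNReal := by
  unfold obsLaw entryLaw
  rw [idle, ← add_smul, ← ENNReal.ofReal_add (by linarith) h0, sub_add_cancel, ENNReal.ofReal_one,
    one_smul, map_prod_dirac_zero]

/-- The adversary who replaces the observation at a contaminated entry with mean `t` by an
independent draw from `Q`. -/
def replaceBy (σ t : ℝ) (Q : Measure ℝ) [IsProbabilityMeasure Q] : Corruption σ where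
  joint := ((noiseLaw σ).prod Q).map fun p => (p.1, p.2 - t - p.1)
  isProb := Measure.isProbabilityMeasure_map (by fun_prop)
  noise_marginal := by
    rw [Measure.fst, Measure.map_map (by fun_prop) (by fun_prop)]
    change Measure.map Prod.fst ((noiseLaw σ).prod Q) = _
    rw [← Measure.fst, Measure.fst_prod]

lemma obsLaw_replaceBy (σ α t : ℝ) (Q : Measure ℝ) [IsProbabilityMeasure Q] :
    obsLaw σ α t (replaceBy σ t Q) =
      ENNReal.ofReal (1 - α) • gaussianReal t (σ ^ 2).toNNReal + ENNReal.ofReal α • Q := by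
  unfold obsLaw entryLaw
  rw [Measure.map_add _ _ (by fun_prop), Measure.map_smul, Measure.map_smul, map_prod_dirac_zero]
  congr 2
  rw [replaceBy, Measure.map_map (by fun_prop) (by fun_prop)]
  have : ((fun p : ℝ × ℝ => t + p.1 + p.2) ∘ fun p : ℝ × ℝ => (p.1, p.2 - t - p.1)) = Prod.snd := by
    funext p; simp
  rw [this, ← Measure.snd, Measure.snd_prod]

/-! ### Contaminations that make two means indistinguishable -/

/-- If `|a| ≤ α σ / √2`, then `N(0, σ²)` and `N(a, σ²)` have total variation distance at most `α`,
and suitable contaminations of rate `α` turn them into the same law. -/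
lemma exists_common_law {σ α a : ℝ} (hσ : 0 < σ) (h0 : 0 < α) (h1 : α ≤ 1)
    (ha : 2 * a ^ 2 ≤ α ^ 2 * σ ^ 2) :
    ∃ Q₀ Q₁ : Measure ℝ, IsProbabilityMeasure Q₀ ∧ IsProbabilityMeasure Q₁ ∧
      ENNReal.ofReal (1 - α) • gaussianReal 0 (σ ^ 2).toNNReal + ENNReal.ofReal α • Q₀ =
        ENNReal.ofReal (1 - α) • gaussianReal a (σ ^ 2).toNNReal + ENNReal.ofReal α • Q₁ := by
  set v := (σ ^ 2).toNNReal with hvdef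
  have hvr : (v : ℝ) = σ ^ 2 := Real.coe_toNNReal _ (sq_nonneg σ)
  have hv : v ≠ 0 := by
    intro h
    rw [h] at hvr
    exact (pow_pos hσ 2).ne hvr
  set P := gaussianReal 0 v with hP
  set Q := gaussianReal a v with hQ
  set L : ℝ → ℝ := gaussLR 0 v a with hL
  set g : ℝ → ℝ≥0∞ := fun x => ENNReal.ofReal (L x) with hg
  have hL0 : ∀ x, 0 ≤ L x := gaussLR_nonneg _ _ _
  have hgm : Measurable g := (measurable_gaussLR 0 v a).ennreal_ofReal
  have hQP : Q = P.withDensity g := by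
    have := gaussianReal_shift 0 hv a
    rwa [zero_add] at this
  -- adding `(g - 1)⁺` to `P` and `(1 - g)⁺` to `Q` gives the same measure, of density `max 1 g`
  set D₁ := P.withDensity fun x => g x - 1 with hD₁
  set D₀ := P.withDensity fun x => 1 - g x with hD₀
  have hD : P + D₁ = Q + D₀ := by
    have e1 : P + D₁ = P.withDensity fun x => max 1 (g x) := by
      nth_rewrite 1 [← withDensity_one (μ := P)]
      rw [hD₁, ← withDensity_add_left measurable_one]
      congr 1
      funext x
      simp [add_tsub_eq_max]
    have e2 : Q + D₀ = P.withDensity fun x => max 1 (g x) := by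
      rw [hQP, hD₀, ← withDensity_add_left hgm]
      congr 1
      funext x
      simp [add_tsub_eq_max, max_comm]
    rw [e1, e2]
  set δ := D₁ Set.univ with hδ
  have hδ0 : D₀ Set.univ = δ := by
    have := congrArg (fun μ : Measure ℝ => μ Set.univ) hD
    simp only [Measure.add_apply, measure_univ] at this
    exact ((ENNReal.add_right_inj ENNReal.one_ne_top).mp this).symm
  have hδα : δ ≤ ENNReal.ofReal α := by
    have key : δ + ENNReal.ofReal (1 / α) ≤ ENNReal.ofReal α + ENNReal.ofReal (1 / α) := by
      have hpt : ∀ x, (g x - 1) + ENNReal.ofReal (1 / α) * g x ≤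
          ENNReal.ofReal (1 / (2 * α)) * g x ^ 2 + ENNReal.ofReal (1 / (2 * α) + α / 2) := by
        intro x
        rw [hg]
        have hLx := hL0 x
        simp only
        rw [← ENNReal.ofReal_one, ← ENNReal.ofReal_sub _ zero_le_one,
          ← ENNReal.ofReal_pow hLx, ← ENNReal.ofReal_mul (by positivity),
          ← ENNReal.ofReal_mul (by positivity),
          ← ENNReal.ofReal_add (show 0 ≤ 1 / (2 * α) * L x ^ 2 by positivity)
            (show 0 ≤ 1 / (2 * α) + α / 2 by positivity)]
        -- this is `(L - 1)⁺ ≤ (L - 1)² / (2 α) + α / 2`, with the square expanded and its negative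
        -- term moved to the left because the integrals are in `[0, ∞]`
        have ident : 1 / (2 * α) * L x ^ 2 + (1 / (2 * α) + α / 2) - 1 / α * L x =
            (L x - 1) ^ 2 / (2 * α) + α / 2 := by field_simp; ring
        have ident2 : (L x - 1) ^ 2 / (2 * α) + α / 2 - (L x - 1) =
            (L x - 1 - α) ^ 2 / (2 * α) := by field_simp; ring
        have p1 : 0 ≤ (L x - 1) ^ 2 / (2 * α) := by positivity
        have p2 : 0 ≤ (L x - 1 - α) ^ 2 / (2 * α) := by positivity
        rcases le_total 1 (L x) with h | h
        · rw [← ENNReal.ofReal_add (by linarith) (by positivity)]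
          exact ENNReal.ofReal_le_ofReal (by linarith)
        · rw [ENNReal.ofReal_of_nonpos (by linarith : L x - 1 ≤ 0), zero_add]
          exact ENNReal.ofReal_le_ofReal (by linarith)
      have hint := lintegral_mono (μ := P) hpt
      rw [lintegral_add_right _ (hgm.const_mul _), lintegral_const_mul _ hgm,
        lintegral_add_left ((hgm.pow_const 2).const_mul _), lintegral_const_mul _ (hgm.pow_const 2),
        lintegral_gaussLR 0 hv, lintegral_gaussLR_sq 0 hv, lintegral_const, measure_univ, mul_one,
        mul_one, hvr] at hint
      have hδint : δ = ∫⁻ x, (g x - 1) ∂P := by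
        rw [hδ, hD₁, withDensity_apply _ MeasurableSet.univ, setLIntegral_univ]
      rw [hδint]
      refine hint.trans ?_
      rw [← ENNReal.ofReal_mul (by positivity), ← ENNReal.ofReal_add (by positivity) (by positivity),
        ← ENNReal.ofReal_add (by positivity) (by positivity)]
      apply ENNReal.ofReal_le_ofReal
      have hb : a ^ 2 / σ ^ 2 ≤ α ^ 2 / 2 := by
        rw [div_le_iff₀ (by positivity)]; linarith
      have hb0 : 0 ≤ a ^ 2 / σ ^ 2 := by positivity
      have hα2 : α ^ 2 ≤ 1 := pow_le_one₀ h0.le h1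
      have hexp : Real.exp (a ^ 2 / σ ^ 2) ≤ 1 + α ^ 2 := by
        refine (Real.exp_bound_div_one_sub_of_interval hb0 (by linarith)).trans ?_
        rw [div_le_iff₀ (by linarith)]
        nlinarith
      have : 1 / (2 * α) * Real.exp (a ^ 2 / σ ^ 2) ≤ 1 / (2 * α) * (1 + α ^ 2) := by gcongr
      have e : 1 / (2 * α) * (1 + α ^ 2) + (1 / (2 * α) + α / 2) = α + 1 / α := by
        field_simp; ring
      linarith
    exact (ENNReal.add_le_add_iff_right ENNReal.ofReal_ne_top).mp key
  set p := ENNReal.ofReal (1 - α) with hp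
  set q := ENNReal.ofReal α with hq
  have hq0 : q ≠ 0 := by simpa [hq] using h0
  have hqt : q ≠ ∞ := ENNReal.ofReal_ne_top
  have hpδ : p * δ ≤ q := by
    calc p * δ ≤ 1 * δ := by
          gcongr
          exact ENNReal.ofReal_le_one.mpr (by linarith)
      _ ≤ q := by rwa [one_mul]
  -- the contaminating laws are `D₁` and `D₀`, filled up to mass one by a multiple of `P`
  have hprob : ∀ D : Measure ℝ, D Set.univ = δ →
      IsProbabilityMeasure (q⁻¹ • (p • D + (q - p * δ) • P)) := fun D hDu => by
    constructor
    simp only [Measure.smul_apply, Measure.add_apply, hDu, measure_univ, smul_eq_mul, mul_one]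
    rw [add_tsub_cancel_of_le hpδ, ENNReal.inv_mul_cancel hq0 hqt]
  have hcancel : ∀ D : Measure ℝ, q • (q⁻¹ • D) = D := fun D => by
    rw [smul_smul, ENNReal.mul_inv_cancel hq0 hqt, one_smul]
  refine ⟨_, _, hprob D₁ rfl, hprob D₀ hδ0, ?_⟩
  rw [hcancel, hcancel, ← add_assoc, ← add_assoc, ← smul_add, ← smul_add, hD]

/-! ### From separated hypotheses to error probabilities -/

section Testing

variable {m : ℕ} {d : Fin m → ℕ}

lemma frobSq_sub_le (Y S T : Tensor d) :
    frobSq (S - T) ≤ 2 * frobSq (Y - S) + 2 * frobSq (Y - T) := by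
  unfold frobSq
  rw [Finset.mul_sum, Finset.mul_sum, ← Finset.sum_add_distrib]
  refine Finset.sum_le_sum fun w _ => ?_
  simp only [Pi.sub_apply]
  nlinarith [sq_nonneg ((Y w - S w) + (Y w - T w))]

lemma measurable_frobSq : Measurable (frobSq (d := d)) :=
  Finset.measurable_sum _ fun w _ => (measurable_pi_apply w).pow_const 2

lemma measurableSet_error_lt {That : Tensor d → Tensor d} (hT : Measurable That) (T : Tensor d)
    (t : ℝ) : MeasurableSet {y | frobSq (That y - T) < t} :=
  measurableSet_lt (measurable_frobSq.comp (hT.sub measurable_const)) measurable_const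

/-- A spread-out tensor can be confused with `0`: the adversary makes both observations have the
same law, and then an estimator fails for one of the two. -/
lemma exists_errorProb_of_spread {σ α t : ℝ} (hσ : 0 < σ) (h0 : 0 < α) (h1 : α ≤ 1)
    {That : Tensor d → Tensor d} (hT : Measurable That) (T : Tensor d)
    (hsup : ∀ w, 2 * T w ^ 2 ≤ α ^ 2 * σ ^ 2) (ht : 4 * t ≤ frobSq T) :
    ∃ S, (S = T ∨ S = 0) ∧ ∃ κ, ENNReal.ofReal (1 / 2) ≤ errorProb σ α κ That S t := by
  choose Q₀ Q₁ hQ₀ hQ₁ hQ using fun w => exists_common_law hσ h0 h1 (hsup w)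
  set κ₀ : Idx d → Corruption σ := fun w => replaceBy σ 0 (Q₀ w) with hκ₀
  set κ₁ : Idx d → Corruption σ := fun w => replaceBy σ (T w) (Q₁ w) with hκ₁
  set M := Measure.pi fun w => obsLaw σ α ((0 : Tensor d) w) (κ₀ w) with hM
  have hlaw : Measure.pi (fun w => obsLaw σ α (T w) (κ₁ w)) = M := by
    rw [hM]
    congr 1
    funext w
    rw [hκ₀, hκ₁]
    simp only [Pi.zero_apply]
    rw [obsLaw_replaceBy, obsLaw_replaceBy, hQ w]
  have hprob : ∀ w, IsProbabilityMeasure (obsLaw σ α ((0 : Tensor d) w) (κ₀ w)) := fun w => by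
    rw [hκ₀]
    simp only [Pi.zero_apply]
    rw [obsLaw_replaceBy]
    exact isProbabilityMeasure_convex h0.le h1 _ _
  have hcover : Set.univ ⊆ {y | t ≤ frobSq (That y - T)} ∪ {y | t ≤ frobSq (That y - 0)} := by
    intro y _
    by_contra hy
    simp only [Set.mem_union, Set.mem_ofPred_eq, not_or, not_le] at hy
    have := frobSq_sub_le (That y) T 0
    rw [sub_zero] at this
    linarith [hy.1, hy.2]
  have hone : 1 ≤ errorProb σ α κ₁ That T t + errorProb σ α κ₀ That 0 t := by
    rw [errorProb_eq h0.le h1 _ hT, errorProb_eq h0.le h1 _ hT, hlaw, ← hM]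
    calc (1 : ℝ≥0∞) = M Set.univ := measure_univ.symm
      _ ≤ _ := (measure_mono hcover).trans (measure_union_le _ _)
  by_contra! hcon
  have a1 := hcon T (Or.inl rfl) κ₁
  have a0 := hcon 0 (Or.inr rfl) κ₀
  have := (hone.trans_lt (ENNReal.add_lt_add a1 a0))
  rw [← ENNReal.ofReal_add (by norm_num) (by norm_num)] at this
  norm_num at this

/-- The Bayesian lower bound for the uncontaminated model, for a family of tensors which no ball of
squared radius `t` covers but for a small fraction. -/
lemma exists_errorProb_of_covering {J : Type*} [Fintype J] [Nonempty J] {σ α b t : ℝ} (hσ : 0 < σ)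
    (h0 : 0 ≤ α) (h1 : α ≤ 1) {That : Tensor d → Tensor d} (hT : Measurable That)
    (T₀ : Tensor d) (T : J → Tensor d) (hb : ∀ j, frobSq (T j - T₀) ≤ σ ^ 2 * b)
    (hcov : ∀ Y : Tensor d, ∑ j, (if frobSq (Y - T j) < t then (1 : ℝ) else 0) ≤
      Real.exp (-2 * b) * Fintype.card J) :
    ∃ j, ENNReal.ofReal (1 - Real.exp (-b / 2)) ≤ errorProb σ α (fun _ => idle σ) That (T j) t := by
  have hvr : (((σ ^ 2).toNNReal : ℝ≥0) : ℝ) = σ ^ 2 := Real.coe_toNNReal _ (sq_nonneg σ)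
  have hv : (σ ^ 2).toNNReal ≠ 0 := by
    intro h
    rw [h] at hvr
    exact (pow_pos hσ 2).ne hvr
  obtain ⟨j, hj⟩ := exists_gaussPi_le T₀ T hv (b := b) (fun j => by rw [hvr]; exact hb j)
    (fun j => {y | frobSq (That y - T j) < t}) (fun j => measurableSet_error_lt hT _ _)
    (fun y => by
      refine le_trans (le_of_eq ?_) (hcov (That y))
      refine Finset.sum_congr rfl fun j _ => ?_
      simp [Set.indicator_apply])
  refine ⟨j, ?_⟩
  rw [errorProb_eq h0 h1 _ hT]
  simp_rw [obsLaw_idle h0 h1]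
  change _ ≤ gaussPi (T j) _ _
  have hc : {y | t ≤ frobSq (That y - T j)} = {y | frobSq (That y - T j) < t}ᶜ := by
    ext y; simp
  rw [hc, prob_compl_eq_one_sub (measurableSet_error_lt hT _ _),
    ENNReal.ofReal_sub _ (Real.exp_pos _).le, ENNReal.ofReal_one]
  exact tsub_le_tsub_left hj _

/-- The exponential generating function of the Hamming distance on the cube. -/
lemma sum_exp_neg_hammingDist {I : Type*} [Fintype I] [DecidableEq I] (v₀ : I → Bool) :
    ∑ v : I → Bool, Real.exp (-(hammingDist v₀ v : ℝ)) =
      (1 + Real.exp (-1)) ^ Fintype.card I := by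
  have : ∀ v : I → Bool, Real.exp (-(hammingDist v₀ v : ℝ)) =
      ∏ i, (if v₀ i ≠ v i then Real.exp (-1) else 1) := fun v => by
    rw [Finset.prod_ite, Finset.prod_const, Finset.prod_const_one, mul_one, ← Real.exp_nat_mul,
      hammingDist]
    congr 1
    ring
  simp_rw [this]
  rw [← Fintype.prod_sum (fun i (c : Bool) => if v₀ i ≠ c then Real.exp (-1) else 1),
    ← Finset.card_univ, ← Finset.prod_const]
  refine Finset.prod_congr rfl fun i _ => ?_
  cases v₀ i <;> simp [add_comm]

lemma one_add_exp_neg_one_le : 1 + Real.exp (-1) ≤ 2 * Real.exp (-1 / 3) := by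
  have h : Real.exp (-1) = Real.exp (-1 / 3) ^ 3 := by
    rw [← Real.exp_nat_mul]; congr 1; norm_num
  rw [h]
  have h1 : (2 / 3 : ℝ) ≤ Real.exp (-1 / 3) := by
    have := Real.add_one_le_exp (-1 / 3 : ℝ)
    linarith
  have h2 : Real.exp (-1 / 3) ≤ 1 := Real.exp_le_one_iff.mpr (by norm_num)
  set y := Real.exp (-1 / 3)
  have : 0 ≤ (1 - y) * (y ^ 2 + y - 1) :=
    mul_nonneg (by linarith) (by nlinarith)
  nlinarith

/-- A cube of hypotheses, whose squared distances are comparable to `s` times the Hamming distance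
with `s` of the order `σ²`, forces an error of the order `s` times the dimension of the cube. -/
lemma exists_errorProb_of_cube {I : Type*} [Fintype I] [DecidableEq I] [Nonempty I] {σ α s K : ℝ} (hσ : 0 < σ)
    (h0 : 0 ≤ α) (h1 : α ≤ 1) {That : Tensor d → Tensor d} (hT : Measurable That)
    (T : (I → Bool) → Tensor d) (hs : 0 < s) (hK : 10 * (K * s) ≤ σ ^ 2)
    (hlow : ∀ u v, s * hammingDist u v ≤ frobSq (T u - T v))
    (hup : ∀ u v, frobSq (T u - T v) ≤ K * s * hammingDist u v) :
    ∃ v, ENNReal.ofReal (1 - Real.exp (-1 / 20)) ≤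
      errorProb σ α (fun _ => idle σ) That (T v) (s * Fintype.card I / 32) := by
  set N : ℝ := (Fintype.card I : ℝ) with hN
  have hN1 : 1 ≤ N := by
    rw [hN]
    exact_mod_cast Fintype.card_pos (α := I)
  have hham : ∀ u v : I → Bool, (hammingDist u v : ℝ) ≤ N := fun u v => by
    rw [hN]; exact_mod_cast hammingDist_le_card_fintype
  obtain ⟨v, hv⟩ := exists_errorProb_of_covering (b := N / 10) (t := s * N / 32) hσ h0 h1 hT
    (T fun _ => false) T (fun v => by
      refine (hup _ _).trans ?_
      have h2 := hham v fun _ => false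
      have h3 : (0 : ℝ) ≤ hammingDist v fun _ => false := by positivity
      rcases le_total 0 (K * s) with hKs | hKs
      · nlinarith
      · have : K * s * (hammingDist v fun _ => false : ℕ) ≤ 0 :=
          mul_nonpos_of_nonpos_of_nonneg hKs h3
        have : 0 ≤ σ ^ 2 * (N / 10) := by positivity
        linarith)
    (fun Y => by
      have hcard : (Fintype.card (I → Bool) : ℝ) = 2 ^ Fintype.card I := by simp
      by_cases hex : ∃ v₀, frobSq (Y - T v₀) < s * N / 32
      · -- a ball that meets the family lies in a ball of twice the radius around a member `T v₀`
        obtain ⟨v₀, hv₀⟩ := hex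
        calc ∑ v, (if frobSq (Y - T v) < s * N / 32 then (1 : ℝ) else 0)
            ≤ ∑ v, Real.exp (N / 8) * Real.exp (-(hammingDist v₀ v : ℝ)) := by
              refine Finset.sum_le_sum fun v _ => ?_
              split_ifs with hv
              · rw [← Real.exp_add]
                apply Real.one_le_exp
                have h2 := hlow v₀ v
                have h3 := frobSq_sub_le Y (T v₀) (T v)
                have h4 : s * hammingDist v₀ v ≤ s * (N / 8) := by linarith
                have := le_of_mul_le_mul_left h4 hs
                linarith
              · positivity
          _ = Real.exp (N / 8) * (1 + Real.exp (-1)) ^ Fintype.card I := by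
              rw [← Finset.mul_sum, sum_exp_neg_hammingDist]
          _ ≤ Real.exp (N / 8) * (2 * Real.exp (-1 / 3)) ^ Fintype.card I := by
              gcongr
              exact one_add_exp_neg_one_le
          _ = Real.exp (N / 8 - N / 3) * 2 ^ Fintype.card I := by
              rw [mul_pow, ← Real.exp_nat_mul, sub_eq_add_neg, Real.exp_add, ← hN]
              rw [show N * (-1 / 3) = -(N / 3) by ring]
              ring
          _ ≤ _ := by
              rw [hcard]
              gcongr
              linarith
      · push Not at hex
        rw [Finset.sum_eq_zero fun v _ => if_neg (not_lt.mpr (hex v))]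
        positivity)
  refine ⟨v, le_trans (ENNReal.ofReal_le_ofReal ?_) hv⟩
  exact sub_le_sub_left (Real.exp_le_exp.mpr (by linarith)) 1

end Testing

open Matrix

/-! ### Equal norm tight frames -/

/-- A matrix with orthonormal columns all of whose rows have the same norm (an equal norm Parseval
frame, given by its rows). The value of the common norm is forced by the trace. -/
def IsEqualNormFrame {ι κ : Type*} [Fintype ι] [Fintype κ] [DecidableEq κ] (U : Matrix ι κ ℝ) :
    Prop :=
  Uᵀ * U = 1 ∧ ∀ i, ∑ l, U i l ^ 2 = (Fintype.card κ : ℝ) / Fintype.card ι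

section Frames

set_option linter.unusedSectionVars false

variable {ι ι' κ κ' P I I' : Type*} [Fintype ι] [Fintype ι'] [Fintype κ] [Fintype κ'] [Fintype P]
  [Fintype I] [Fintype I'] [DecidableEq κ] [DecidableEq κ']

lemma transpose_mul_self_eq_one_iff {U : Matrix ι κ ℝ} :
    Uᵀ * U = 1 ↔ ∀ a b, ∑ i, U i a * U i b = if a = b then 1 else 0 := by
  rw [← Matrix.ext_iff]
  simp only [mul_apply, transpose_apply, one_apply]

lemma IsEqualNormFrame.inner_col {U : Matrix ι κ ℝ} (hU : IsEqualNormFrame U) (a b : κ) :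
    ∑ i, U i a * U i b = if a = b then 1 else 0 := transpose_mul_self_eq_one_iff.mp hU.1 a b

lemma IsEqualNormFrame.sq_le {U : Matrix ι κ ℝ} (hU : IsEqualNormFrame U) (i : ι) (a : κ) :
    U i a ^ 2 ≤ (Fintype.card κ : ℝ) / Fintype.card ι := by
  rw [← hU.2 i]
  exact Finset.single_le_sum (f := fun l => U i l ^ 2) (fun _ _ => sq_nonneg _) (Finset.mem_univ a)

/-- A square matrix with orthonormal columns is an equal norm frame. -/
lemma isEqualNormFrame_of_orthogonal {U : Matrix κ κ ℝ} (hU : Uᵀ * U = 1) :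
    IsEqualNormFrame U := by
  refine ⟨hU, fun i => ?_⟩
  have h : U * Uᵀ = 1 := mul_eq_one_comm.mp hU
  replace h := congrFun (congrFun h i) i
  simp only [mul_apply, transpose_apply, one_apply_eq] at h
  have : (Fintype.card κ : ℝ) ≠ 0 := by
    have : 0 < Fintype.card κ := Fintype.card_pos_iff.mpr ⟨i⟩
    positivity
  rw [div_self this, ← h]
  exact Finset.sum_congr rfl fun _ _ => sq _

lemma IsEqualNormFrame.submatrix {U : Matrix ι κ ℝ} (hU : IsEqualNormFrame U) (e : ι' ≃ ι)
    (f : κ' ≃ κ) : IsEqualNormFrame (U.submatrix e f) := by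
  constructor
  · rw [transpose_submatrix, submatrix_mul_equiv, hU.1, submatrix_one_equiv]
  · intro i
    rw [Fintype.card_congr e, Fintype.card_congr f, ← hU.2 (e i)]
    exact Equiv.sum_comp f fun l => U (e i) l ^ 2

/-- Stacking two matrices with weights proportional to the square roots of their sizes. -/
def stack (U : Matrix ι κ ℝ) (V : Matrix ι' κ ℝ) : Matrix (ι ⊕ ι') κ ℝ :=
  fromRows (√((Fintype.card ι : ℝ) / Fintype.card (ι ⊕ ι')) • U)
    (√((Fintype.card ι' : ℝ) / Fintype.card (ι ⊕ ι')) • V)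

lemma IsEqualNormFrame.stack [Nonempty ι] {U : Matrix ι κ ℝ} {V : Matrix ι' κ ℝ}
    (hU : IsEqualNormFrame U) (hV : IsEqualNormFrame V) : IsEqualNormFrame (stack U V) := by
  have hpos : (0 : ℝ) < Fintype.card ι := by exact_mod_cast Fintype.card_pos (α := ι)
  have hcard : (Fintype.card (ι ⊕ ι') : ℝ) = Fintype.card ι + Fintype.card ι' := by
    simp
  constructor
  · rw [transpose_mul_self_eq_one_iff]
    intro a b
    simp only [RobustTensor.stack, Fintype.sum_sum_type, fromRows_apply_inl, fromRows_apply_inr,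
      Matrix.smul_apply, smul_eq_mul]
    have h1 : ∀ c x y : ℝ, 0 ≤ c → √c * x * (√c * y) = c * (x * y) := fun c x y hc => by
      rw [mul_mul_mul_comm, Real.mul_self_sqrt hc]
    simp_rw [h1 _ _ _ (div_nonneg (Nat.cast_nonneg (Fintype.card ι)) (Nat.cast_nonneg _)),
      h1 _ _ _ (div_nonneg (Nat.cast_nonneg (Fintype.card ι')) (Nat.cast_nonneg _)),
      ← Finset.mul_sum, hU.inner_col, hV.inner_col, ← add_mul, ← add_div]
    rw [← hcard, div_self (by rw [hcard]; positivity), one_mul]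
  · rintro (i | i)
    · simp only [RobustTensor.stack, fromRows_apply_inl, Matrix.smul_apply, smul_eq_mul, mul_pow,
        ← Finset.mul_sum, hU.2]
      rw [Real.sq_sqrt (by positivity), div_mul_div_comm, mul_comm, mul_div_mul_right _ _ hpos.ne']
    · have hpos' : (0 : ℝ) < Fintype.card ι' := by
        have : Nonempty ι' := ⟨i⟩
        exact_mod_cast Fintype.card_pos (α := ι')
      simp only [RobustTensor.stack, fromRows_apply_inr, Matrix.smul_apply, smul_eq_mul, mul_pow,
        ← Finset.mul_sum, hV.2]
      rw [Real.sq_sqrt (by positivity), div_mul_div_comm, mul_comm, mul_div_mul_right _ _ hpos'.ne']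

/-- Stacking a family of matrices of the same size, with equal weights. -/
def blocks (U : P → Matrix ι κ ℝ) : Matrix (P × ι) κ ℝ :=
  of fun p l => (√(Fintype.card P : ℝ))⁻¹ * U p.1 p.2 l

lemma isEqualNormFrame_blocks [Nonempty P] {U : P → Matrix ι κ ℝ}
    (hU : ∀ p, IsEqualNormFrame (U p)) : IsEqualNormFrame (blocks U) := by
  have hpos : (0 : ℝ) < Fintype.card P := by exact_mod_cast Fintype.card_pos (α := P)
  constructor
  · rw [transpose_mul_self_eq_one_iff]
    intro a b
    simp only [blocks, of_apply, Fintype.sum_prod_type]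
    have h1 : ∀ p i, (√(Fintype.card P : ℝ))⁻¹ * U p i a * ((√(Fintype.card P : ℝ))⁻¹ * U p i b) =
        (Fintype.card P : ℝ)⁻¹ * (U p i a * U p i b) := fun p i => by
      rw [mul_mul_mul_comm, ← mul_inv, Real.mul_self_sqrt hpos.le]
    simp_rw [h1, ← Finset.mul_sum, (hU _).inner_col, Finset.sum_const, Finset.card_univ,
      nsmul_eq_mul]
    rw [← mul_assoc, inv_mul_cancel₀ hpos.ne', one_mul]
  · rintro ⟨p, i⟩
    simp only [blocks, of_apply, mul_pow, ← Finset.mul_sum, (hU p).2, Fintype.card_prod]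
    rw [inv_pow, Real.sq_sqrt hpos.le]
    push_cast
    rw [inv_mul_eq_div, div_div, mul_comm (Fintype.card ι : ℝ)]

/-- The Naimark complement: extending the columns of an equal norm frame to an orthonormal basis
gives an equal norm frame with the complementary number of columns. -/
lemma IsEqualNormFrame.exists_complement [DecidableEq ι] {U : Matrix ι κ ℝ}
    (hU : IsEqualNormFrame U) (h : Fintype.card κ + Fintype.card κ' = Fintype.card ι) :
    ∃ V : Matrix ι κ' ℝ, IsEqualNormFrame V := by
  let f : κ ⊕ κ' → EuclideanSpace ℝ ι :=
    Sum.elim (fun a => WithLp.toLp 2 fun i => U i a) fun _ => 0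
  have hf : Orthonormal ℝ ((Set.range (Sum.inl : κ → κ ⊕ κ')).domRestrict f) := by
    rw [orthonormal_iff_ite]
    rintro ⟨_, a, rfl⟩ ⟨_, b, rfl⟩
    have := hU.inner_col b a
    simp only [Set.domRestrict_apply, f, Sum.elim_inl, PiLp.inner_apply, RCLike.inner_apply,
      conj_trivial]
    rw [this]
    rcases eq_or_ne a b with rfl | hab
    · simp
    · rw [if_neg hab.symm, if_neg fun h' => hab (Sum.inl.inj (congrArg Subtype.val h'))]
  obtain ⟨B, hB⟩ := hf.exists_orthonormalBasis_extension_of_card_eq (by simp [← h])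
  let M : Matrix ι (κ ⊕ κ') ℝ := of fun i j => B j i
  have hM : Mᵀ * M = 1 := by
    rw [transpose_mul_self_eq_one_iff]
    intro a b
    have := (orthonormal_iff_ite.mp B.orthonormal) b a
    simp only [PiLp.inner_apply, RCLike.inner_apply, conj_trivial] at this
    simp only [M, of_apply]
    rw [this]
    simp [eq_comm]
  have hM' : M * Mᵀ = 1 :=
    (mul_eq_one_comm_of_card_eq _ _ _ (by simp [h])).mp hM
  refine ⟨of fun i j => M i (Sum.inr j), ?_, fun i => ?_⟩
  · rw [transpose_mul_self_eq_one_iff] at hM ⊢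
    intro a b
    have := hM (Sum.inr a) (Sum.inr b)
    simpa using this
  · have h1 := congrFun (congrFun hM' i) i
    simp only [mul_apply, transpose_apply, one_apply_eq, Fintype.sum_sum_type] at h1
    have h2 : ∑ a, M i (Sum.inl a) * M i (Sum.inl a) =
        (Fintype.card κ : ℝ) / Fintype.card ι := by
      rw [← hU.2 i]
      refine Finset.sum_congr rfl fun a _ => ?_
      rw [← sq]
      simp only [M, of_apply, hB (Sum.inl a) ⟨a, rfl⟩, f, Sum.elim_inl]
    have hpos : (0 : ℝ) < Fintype.card ι := by
      have : Nonempty ι := ⟨i⟩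
      exact_mod_cast Fintype.card_pos (α := ι)
    have hc : (Fintype.card κ : ℝ) + Fintype.card κ' = Fintype.card ι := by exact_mod_cast h
    simp only [of_apply, sq]
    rw [h2] at h1
    rw [eq_sub_of_add_eq' h1, ← hc]
    rw [← hc] at hpos
    field_simp
    ring

/-- Equal norm tight frames exist in all sizes, by a Euclidean algorithm on the pair `(d, r)`:
stacking with the identity reduces `d` by `r`, and complementation replaces `r` by `d - r`. -/
lemma exists_isEqualNormFrame (d r : ℕ) (hr : 1 ≤ r) (hrd : r ≤ d) :
    ∃ U : Matrix (Fin d) (Fin r) ℝ, IsEqualNormFrame U := by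
  induction d using Nat.strong_induction_on generalizing r with
  | _ d ih =>
    have hone : ∀ n, IsEqualNormFrame (1 : Matrix (Fin n) (Fin n) ℝ) := fun n =>
      isEqualNormFrame_of_orthogonal (by simp)
    have hstack : ∀ n, 1 ≤ n → 2 * n ≤ d →
        (∃ V : Matrix (Fin (d - n)) (Fin n) ℝ, IsEqualNormFrame V) →
        ∃ U : Matrix (Fin d) (Fin n) ℝ, IsEqualNormFrame U := by
      rintro n hn hnd ⟨V, hV⟩
      have : Nonempty (Fin n) := ⟨⟨0, hn⟩⟩
      have e : Fin d ≃ Fin n ⊕ Fin (d - n) := Fintype.equivOfCardEq (by simp; omega)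
      exact ⟨_, ((hone n).stack hV).submatrix e (Equiv.refl _)⟩
    rcases hrd.eq_or_lt with rfl | hlt
    · exact ⟨1, hone r⟩
    by_cases h2 : 2 * r ≤ d
    · exact hstack r hr h2 (ih (d - r) (by omega) r hr (by omega))
    · obtain ⟨U, hU⟩ := hstack (d - r) (by omega) (by omega)
        (ih (d - (d - r)) (by omega) (d - r) (by omega) (by omega))
      exact hU.exists_complement (by simp; omega)

/-! ### Cubes of equal norm tight frames -/

/-- The squared Frobenius norm of a matrix. -/
def matSq (A : Matrix ι κ ℝ) : ℝ := ∑ i, ∑ j, A i j ^ 2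

lemma matSq_smul (c : ℝ) (A : Matrix ι κ ℝ) : matSq (c • A) = c ^ 2 * matSq A := by
  simp [matSq, mul_pow, Finset.mul_sum]

attribute [local instance] Matrix.frobeniusNormedRing Matrix.frobeniusNormedAlgebra

lemma frobenius_norm_sq (A : Matrix κ κ ℝ) : ‖A‖ ^ 2 = matSq A := by
  rw [frobenius_norm_def, ← Real.sqrt_eq_rpow, Real.sq_sqrt (by positivity)]
  simp [matSq]

/-- The Cayley transform of a skew-symmetric matrix. -/
def cayley (S : Matrix κ κ ℝ) : Matrix κ κ ℝ := (1 - S) * (1 + S)⁻¹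

lemma isUnit_det_one_add_of_skew {S : Matrix κ κ ℝ} (hS : Sᵀ = -S) : IsUnit (1 + S).det := by
  rw [isUnit_iff_ne_zero]
  intro h
  obtain ⟨x, hx, h0⟩ := exists_mulVec_eq_zero_iff.mpr h
  have h1 : x ⬝ᵥ S *ᵥ x = 0 := by
    have : x ⬝ᵥ S *ᵥ x = -(x ⬝ᵥ S *ᵥ x) := by
      conv_lhs => rw [dotProduct_comm, ← vecMul_transpose, ← dotProduct_mulVec, hS]
      rw [neg_mulVec, dotProduct_neg]
    linarith
  have h2 : x ⬝ᵥ (1 + S) *ᵥ x = 0 := by rw [h0, dotProduct_zero]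
  rw [add_mulVec, one_mulVec, dotProduct_add, h1, add_zero] at h2
  exact hx (dotProduct_self_eq_zero.mp h2)

lemma cayley_orthogonal {S : Matrix κ κ ℝ} (hS : Sᵀ = -S) : (cayley S)ᵀ * cayley S = 1 := by
  have hA := isUnit_det_one_add_of_skew hS
  have hB : IsUnit (1 - S).det := by
    have : (1 + S)ᵀ = 1 - S := by rw [transpose_add, transpose_one, hS, sub_eq_add_neg]
    rw [← this, det_transpose]
    exact hA
  have hT : (cayley S)ᵀ = (1 - S)⁻¹ * (1 + S) := by
    rw [cayley, transpose_mul, transpose_nonsing_inv, transpose_add, transpose_sub, transpose_one,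
      hS, sub_neg_eq_add, ← sub_eq_add_neg]
  have hcomm : (1 + S) * (1 - S) = (1 - S) * (1 + S) := by noncomm_ring
  rw [hT, cayley, Matrix.mul_assoc, ← Matrix.mul_assoc (1 + S), hcomm, Matrix.mul_assoc,
    mul_nonsing_inv _ hA, Matrix.mul_one, nonsing_inv_mul _ hB]

/-- The Cayley transform does not move the columns on which the skew-symmetric matrix vanishes. -/
lemma cayley_apply_of_col_eq_zero {S : Matrix κ κ ℝ} (hS : Sᵀ = -S) {k : κ} (hk : ∀ i, S i k = 0)
    (i : κ) : cayley S i k = (1 : Matrix κ κ ℝ) i k := by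
  have hA := isUnit_det_one_add_of_skew hS
  have hSe : S *ᵥ Pi.single k 1 = 0 := by
    ext j; simp [hk]
  have h1 : (1 + S) *ᵥ Pi.single k 1 = Pi.single k 1 := by
    rw [add_mulVec, one_mulVec, hSe, add_zero]
  have h2 : (1 + S)⁻¹ *ᵥ Pi.single k 1 = Pi.single k 1 := by
    conv_lhs => rw [← h1, mulVec_mulVec, nonsing_inv_mul _ hA, one_mulVec]
  have h3 : cayley S *ᵥ Pi.single k 1 = Pi.single k 1 := by
    rw [cayley, ← mulVec_mulVec, h2, sub_mulVec, one_mulVec, hSe, sub_zero]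
  have := congrFun h3 i
  rw [mulVec_single_one] at this
  rw [← col_apply (cayley S), this, one_apply, Pi.single_apply]

/-- Near the origin the Cayley transform is bi-Lipschitz in the Frobenius norm, since
`(1 + S) (cayley S - cayley S') (1 + S') = 2 (S' - S)`. -/
lemma matSq_cayley_sub {S S' : Matrix κ κ ℝ} (hS : Sᵀ = -S) (hS' : S'ᵀ = -S')
    (hn : matSq S ≤ 1 / 4) (hn' : matSq S' ≤ 1 / 4) :
    64 / 81 * matSq (S - S') ≤ matSq (cayley S - cayley S') ∧
      matSq (cayley S - cayley S') ≤ 64 * matSq (S - S') := by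
  have hA := isUnit_det_one_add_of_skew hS
  have hA' := isUnit_det_one_add_of_skew hS'
  set D := cayley S - cayley S' with hD
  have hcay : ∀ R : Matrix κ κ ℝ, Rᵀ = -R → cayley R = (2 : ℝ) • (1 + R)⁻¹ - 1 := fun R hR => by
    have h : (1 - R) = (2 : ℝ) • (1 : Matrix κ κ ℝ) - (1 + R) := by rw [two_smul]; abel
    rw [cayley, h, Matrix.sub_mul, smul_mul_assoc, Matrix.one_mul,
      mul_nonsing_inv _ (isUnit_det_one_add_of_skew hR)]
  have key : (1 + S) * D * (1 + S') = (2 : ℝ) • (S' - S) := by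
    have : D = (2 : ℝ) • ((1 + S)⁻¹ - (1 + S')⁻¹) := by
      rw [hD, hcay S hS, hcay S' hS', smul_sub]; abel
    rw [this, mul_smul_comm, smul_mul_assoc, Matrix.mul_sub, Matrix.sub_mul,
      mul_nonsing_inv _ hA, Matrix.mul_assoc (1 + S), nonsing_inv_mul _ hA', Matrix.one_mul,
      Matrix.mul_one]
    congr 1
    abel
  have half : ∀ R : Matrix κ κ ℝ, matSq R ≤ 1 / 4 → ‖R‖ ≤ 1 / 2 := fun R hR => by
    rw [← frobenius_norm_sq] at hR
    nlinarith [norm_nonneg R]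
  have h1 := half S hn
  have h2 := half S' hn'
  have left_le : ∀ X : Matrix κ κ ℝ, ‖(1 + S) * X‖ ≤ 3 / 2 * ‖X‖ ∧ 1 / 2 * ‖X‖ ≤ ‖(1 + S) * X‖ := by
    intro X
    have e : (1 + S) * X = X + S * X := by rw [Matrix.add_mul, Matrix.one_mul]
    have hm : ‖S * X‖ ≤ 1 / 2 * ‖X‖ := (norm_mul_le _ _).trans (by gcongr)
    rw [e]
    have a1 := norm_add_le X (S * X)
    have a2 := norm_sub_le (X + S * X) (S * X)
    rw [add_sub_cancel_right] at a2
    constructor <;> linarith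
  have right_le : ∀ X : Matrix κ κ ℝ,
      ‖X * (1 + S')‖ ≤ 3 / 2 * ‖X‖ ∧ 1 / 2 * ‖X‖ ≤ ‖X * (1 + S')‖ := by
    intro X
    have e : X * (1 + S') = X + X * S' := by rw [Matrix.mul_add, Matrix.mul_one]
    have hm : ‖X * S'‖ ≤ 1 / 2 * ‖X‖ := (norm_mul_le _ _).trans (by
      rw [mul_comm]; gcongr)
    rw [e]
    have a1 := norm_add_le X (X * S')
    have a2 := norm_sub_le (X + X * S') (X * S')
    rw [add_sub_cancel_right] at a2
    constructor <;> linarith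
  have hnorm : ‖(1 + S) * D * (1 + S')‖ = 2 * ‖S - S'‖ := by
    rw [key, norm_smul, norm_sub_rev]; norm_num
  have u1 := (left_le D).1
  have u2 := (right_le ((1 + S) * D)).1
  have l1 := (left_le D).2
  have l2 := (right_le ((1 + S) * D)).2
  rw [← frobenius_norm_sq, ← frobenius_norm_sq]
  have n1 := norm_nonneg D
  have n2 := norm_nonneg (S - S')
  constructor
  · have : 8 / 9 * ‖S - S'‖ ≤ ‖D‖ := by linarith
    calc 64 / 81 * ‖S - S'‖ ^ 2 = (8 / 9 * ‖S - S'‖) ^ 2 := by ring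
      _ ≤ ‖D‖ ^ 2 := by gcongr
  · have : ‖D‖ ≤ 8 * ‖S - S'‖ := by linarith
    calc ‖D‖ ^ 2 ≤ (8 * ‖S - S'‖) ^ 2 := by gcongr
      _ = 64 * ‖S - S'‖ ^ 2 := by ring

/-- A family of equal norm frames indexed by a cube, with a common column `k`, in which the squared
Frobenius distance is comparable, up to the factor `81`, to `s` times the Hamming distance. -/
structure IsFrameCube (k : κ) (s : ℝ) (U : (I → Bool) → Matrix ι κ ℝ) : Prop where
  frame : ∀ v, IsEqualNormFrame (U v)
  col_eq : ∀ u v i, U u i k = U v i k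
  le_matSq : ∀ u v, s * hammingDist u v ≤ matSq (U u - U v)
  matSq_le : ∀ u v, matSq (U u - U v) ≤ 81 * s * hammingDist u v

lemma hammingDist_eq_sum (u v : I → Bool) :
    (hammingDist u v : ℝ) = ∑ i, if u i ≠ v i then (1 : ℝ) else 0 := by
  rw [Finset.sum_boole, hammingDist]

lemma IsFrameCube.reindex {k : κ} {s : ℝ} {U : (I → Bool) → Matrix ι κ ℝ}
    (hU : IsFrameCube k s U) (e : ι' ≃ ι) (f : κ' ≃ κ) (g : I ≃ I') :
    IsFrameCube (f.symm k) s fun v => (U (v ∘ g)).submatrix e f := by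
  have hmat : ∀ u v : I' → Bool, matSq ((U (u ∘ g)).submatrix e f - (U (v ∘ g)).submatrix e f) =
      matSq (U (u ∘ g) - U (v ∘ g)) := fun u v => by
    unfold matSq
    rw [← Equiv.sum_comp e]
    refine Finset.sum_congr rfl fun i _ => ?_
    rw [← Equiv.sum_comp f]
    rfl
  have hham : ∀ u v : I' → Bool, hammingDist (u ∘ g) (v ∘ g) = hammingDist u v := fun u v => by
    have : (hammingDist (u ∘ g) (v ∘ g) : ℝ) = hammingDist u v := by
      rw [hammingDist_eq_sum, hammingDist_eq_sum]
      exact Equiv.sum_comp g fun i => if u i ≠ v i then (1 : ℝ) else 0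
    exact_mod_cast this
  refine ⟨fun v => (hU.frame _).submatrix e f, fun u v i => ?_, fun u v => ?_, fun u v => ?_⟩
  · simpa using hU.col_eq (u ∘ g) (v ∘ g) (e i)
  · rw [hmat, ← hham]; exact hU.le_matSq _ _
  · rw [hmat, ← hham]; exact hU.matSq_le _ _

lemma IsFrameCube.blocks [Nonempty P] {k : κ} {s : ℝ} {U : (I → Bool) → Matrix ι κ ℝ}
    (hU : IsFrameCube k s U) :
    IsFrameCube k (s / Fintype.card P)
      fun v : P × I → Bool => blocks fun p => U fun i => v (p, i) := by
  have hpos : (0 : ℝ) < Fintype.card P := by exact_mod_cast Fintype.card_pos (α := P)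
  have hmat : ∀ A B : P → Matrix ι κ ℝ, matSq (RobustTensor.blocks A - RobustTensor.blocks B) =
      (∑ p, matSq (A p - B p)) / Fintype.card P := fun A B => by
    simp only [matSq, RobustTensor.blocks, Fintype.sum_prod_type, Matrix.sub_apply, of_apply, ← mul_sub,
      mul_pow, inv_pow, Real.sq_sqrt hpos.le, ← Finset.mul_sum]
    rw [inv_mul_eq_div]
  have hham : ∀ u v : P × I → Bool, (hammingDist u v : ℝ) =
      ∑ p, (hammingDist (fun i => u (p, i)) (fun i => v (p, i)) : ℝ) := fun u v => by
    simp only [hammingDist_eq_sum, Fintype.sum_prod_type]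
  refine ⟨fun v => isEqualNormFrame_blocks fun p => hU.frame _, fun u v i => ?_,
    fun u v => ?_, fun u v => ?_⟩
  · simp only [RobustTensor.blocks, of_apply]
    rw [hU.col_eq]
  · rw [hmat, hham, div_mul_eq_mul_div, Finset.mul_sum]
    gcongr
    exact hU.le_matSq _ _
  · rw [hmat, hham, mul_div_assoc', div_mul_eq_mul_div, Finset.mul_sum]
    gcongr
    exact hU.matSq_le _ _

lemma IsFrameCube.stack [Nonempty ι] {k : κ} {s : ℝ} {U : (I → Bool) → Matrix ι κ ℝ}
    (hU : IsFrameCube k s U) {V : Matrix ι' κ ℝ} (hV : IsEqualNormFrame V) :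
    IsFrameCube k ((Fintype.card ι : ℝ) / Fintype.card (ι ⊕ ι') * s) fun v => stack (U v) V := by
  have hmat : ∀ A B : Matrix ι κ ℝ, matSq (RobustTensor.stack A V - RobustTensor.stack B V) =
      (Fintype.card ι : ℝ) / Fintype.card (ι ⊕ ι') * matSq (A - B) := fun A B => by
    rw [← Real.sq_sqrt (show (0 : ℝ) ≤ (Fintype.card ι : ℝ) / Fintype.card (ι ⊕ ι') by positivity),
      ← matSq_smul, smul_sub]
    simp [matSq, RobustTensor.stack, Fintype.sum_sum_type]
  refine ⟨fun v => (hU.frame v).stack hV, fun u v i => ?_, fun u v => ?_, fun u v => ?_⟩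
  · rcases i with i | i
    · simp only [RobustTensor.stack, fromRows_apply_inl, Matrix.smul_apply]
      rw [hU.col_eq]
    · simp only [RobustTensor.stack, fromRows_apply_inr]
  · rw [hmat, mul_assoc]
    exact mul_le_mul_of_nonneg_left (hU.le_matSq _ _) (by positivity)
  · rw [hmat, mul_left_comm, mul_assoc]
    exact mul_le_mul_of_nonneg_left (hU.matSq_le _ _) (by positivity)

/-- The skew-symmetric matrix with an off-diagonal block `B`, padded by a zero row and column. -/
def skewBlock {a b : ℕ} (B : Matrix (Fin b) (Fin a) ℝ) :
    Matrix (Unit ⊕ (Fin a ⊕ Fin b)) (Unit ⊕ (Fin a ⊕ Fin b)) ℝ :=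
  fromBlocks 0 0 0 (fromBlocks 0 (-Bᵀ) B 0)

lemma skewBlock_transpose {a b : ℕ} (B : Matrix (Fin b) (Fin a) ℝ) :
    (skewBlock B)ᵀ = -skewBlock B := by
  simp [skewBlock, fromBlocks_transpose, fromBlocks_neg]

lemma skewBlock_sub {a b : ℕ} (B C : Matrix (Fin b) (Fin a) ℝ) :
    skewBlock B - skewBlock C = skewBlock (B - C) := by
  ext i j
  rcases i with i | i | i <;> rcases j with j | j | j <;> simp [skewBlock]
  ring

lemma matSq_skewBlock {a b : ℕ} (B : Matrix (Fin b) (Fin a) ℝ) :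
    matSq (skewBlock B) = 2 * matSq B := by
  simp only [matSq, skewBlock, Fintype.sum_sum_type, fromBlocks_apply₁₁, fromBlocks_apply₁₂,
    fromBlocks_apply₂₁, fromBlocks_apply₂₂, Matrix.zero_apply, Matrix.neg_apply, transpose_apply, neg_sq]
  simp only [ne_eq, OfNat.ofNat_ne_zero, not_false_eq_true, zero_pow, Finset.sum_const_zero,
    zero_add, add_zero]
  rw [Finset.sum_comm]
  ring

/-- The Cayley transforms of small skew-symmetric matrices with a free block of size `b × a` form a
cube of dimension `b a` of orthogonal matrices. -/
lemma exists_isFrameCube_orthogonal (a b : ℕ) :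
    ∃ (s : ℝ) (U : (Fin b × Fin a → Bool) →
      Matrix (Unit ⊕ (Fin a ⊕ Fin b)) (Unit ⊕ (Fin a ⊕ Fin b)) ℝ),
      0 < s ∧ IsFrameCube (Sum.inl ()) s U := by
  -- the entries `δ` are so small that all skew-symmetric matrices have Frobenius norm at most `1/2`
  set δ : ℝ := 1 / (4 * (1 + b * a)) with hδ
  have hδ0 : 0 < δ := by positivity
  have hδab : (b : ℝ) * a * δ ^ 2 ≤ 1 / 8 := by
    have h1 : (b : ℝ) * a * δ ≤ 1 / 4 := by
      rw [hδ, mul_one_div, div_le_iff₀ (by positivity)]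
      linarith
    have h2 : δ ≤ 1 / 4 := by
      rw [hδ]
      apply one_div_le_one_div_of_le (by norm_num)
      have : (0 : ℝ) ≤ b * a := by positivity
      linarith
    calc (b : ℝ) * a * δ ^ 2 = (b * a * δ) * δ := by ring
      _ ≤ 1 / 4 * (1 / 4) := by gcongr
      _ ≤ 1 / 8 := by norm_num
  let B : (Fin b × Fin a → Bool) → Matrix (Fin b) (Fin a) ℝ :=
    fun v => of fun i j => if v (i, j) then δ else 0
  have hBsq : ∀ v, matSq (B v) ≤ 1 / 8 := fun v => by
    refine le_trans ?_ hδab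
    have : ∀ i j, B v i j ^ 2 ≤ δ ^ 2 := fun i j => by
      simp only [B, of_apply]
      split_ifs
      · exact le_rfl
      · rw [zero_pow two_ne_zero]; positivity
    calc matSq (B v) ≤ ∑ _i : Fin b, ∑ _j : Fin a, δ ^ 2 :=
          Finset.sum_le_sum fun i _ => Finset.sum_le_sum fun j _ => this i j
      _ = _ := by simp; ring
  have hBsub : ∀ u v, matSq (B u - B v) = δ ^ 2 * hammingDist u v := fun u v => by
    rw [hammingDist_eq_sum, Fintype.sum_prod_type, Finset.mul_sum]
    refine Finset.sum_congr rfl fun i _ => ?_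
    rw [Finset.mul_sum]
    refine Finset.sum_congr rfl fun j _ => ?_
    simp only [B, Matrix.sub_apply, of_apply]
    by_cases hu : u (i, j) <;> by_cases hv : v (i, j) <;> simp [hu, hv]
  have hsmall : ∀ v, matSq (skewBlock (B v)) ≤ 1 / 4 := fun v => by
    rw [matSq_skewBlock]; linarith [hBsq v]
  have hbd := fun u v => matSq_cayley_sub (skewBlock_transpose (B u)) (skewBlock_transpose (B v))
    (hsmall u) (hsmall v)
  simp only [skewBlock_sub, matSq_skewBlock, hBsub] at hbd
  refine ⟨128 / 81 * δ ^ 2, fun v => cayley (skewBlock (B v)), by positivity,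
    fun v => isEqualNormFrame_of_orthogonal (cayley_orthogonal (skewBlock_transpose _)),
    fun u v i => ?_, fun u v => ?_, fun u v => ?_⟩
  · have hcol : ∀ w i, skewBlock (B w) i (Sum.inl ()) = 0 := fun w i => by
      rcases i with i | i <;> simp [skewBlock]
    rw [cayley_apply_of_col_eq_zero (skewBlock_transpose _) (hcol u),
      cayley_apply_of_col_eq_zero (skewBlock_transpose _) (hcol v)]
  · refine le_trans (le_of_eq ?_) (hbd u v).1; ring
  · refine (hbd u v).2.trans (le_of_eq ?_); ring

end Frames

/-- For `3 ≤ r ≤ d / 2` there is a cube of equal norm frames of dimension of the order `d r`: most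
of the rows are filled with scaled orthogonal matrices, which can be moved independently. -/
lemma exists_isFrameCube {d r : ℕ} (hr : 3 ≤ r) (hd : 2 * r ≤ d) (k : Fin r) :
    ∃ (N : ℕ) (s : ℝ) (U : (Fin N → Bool) → Matrix (Fin d) (Fin r) ℝ),
      d * r ≤ 27 * N ∧ 0 < s ∧ IsFrameCube k s U := by
  -- `q` blocks of `r` rows are free; the remaining `e` rows have to support a frame of their own
  obtain ⟨q, e, hq, he, her, rfl⟩ : ∃ q e, 1 ≤ q ∧ r ≤ e ∧ e < 2 * r ∧ d = q * r + e := by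
    have h2 : 2 ≤ d / r := (Nat.le_div_iff_mul_le (by omega)).mpr hd
    have h3 := Nat.div_add_mod d r
    have h4 := Nat.mod_lt d (show 0 < r by omega)
    refine ⟨d / r - 1, r + d % r, by omega, by omega, by omega, ?_⟩
    obtain ⟨c, hc⟩ : ∃ c, d / r = c + 1 := ⟨d / r - 1, by omega⟩
    rw [hc] at h3 ⊢
    rw [Nat.add_sub_cancel]
    generalize d % r = x at h3 ⊢
    linarith [h3, show r * (c + 1) = c * r + r by ring]
  obtain ⟨a, b, hab, hsq⟩ : ∃ a b, 1 + (a + b) = r ∧ r * r ≤ 9 * (b * a) := by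
    obtain ⟨t, rfl | rfl⟩ := Nat.even_or_odd' r
    · obtain ⟨t, rfl⟩ : ∃ u, t = u + 2 := ⟨t - 2, by omega⟩
      exact ⟨t + 1, t + 2, by omega, by nlinarith⟩
    · obtain ⟨t, rfl⟩ : ∃ u, t = u + 1 := ⟨t - 1, by omega⟩
      exact ⟨t + 1, t + 1, by omega, by nlinarith⟩
  obtain ⟨s, U, hs, hU⟩ := exists_isFrameCube_orthogonal a b
  obtain ⟨V, hV⟩ := exists_isEqualNormFrame e r (by omega) he
  have hq' : Nonempty (Fin q) := ⟨⟨0, hq⟩⟩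
  let f₀ : Fin r ≃ Unit ⊕ (Fin a ⊕ Fin b) := Fintype.equivOfCardEq (by simp [← hab])
  let f := f₀.trans (Equiv.swap (f₀ k) (Sum.inl ()))
  have hf : f.symm (Sum.inl ()) = k := by simp [f]
  let e₁ : Fin (q * r + e) ≃ (Fin q × (Unit ⊕ (Fin a ⊕ Fin b))) ⊕ Fin e :=
    Fintype.equivOfCardEq (by simp [hab])
  let g : Fin q × (Fin b × Fin a) ≃ Fin (q * (b * a)) := Fintype.equivOfCardEq (by simp)
  have hcube := (((hU.blocks (P := Fin q)).stack (hV.submatrix (Equiv.refl _) f.symm)).reindex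
    e₁ f g)
  rw [hf] at hcube
  refine ⟨_, _, _, ?_, ?_, hcube⟩
  · calc (q * r + e) * r ≤ (q * r + 2 * (q * r)) * r := by
          gcongr
          nlinarith
      _ = 3 * q * (r * r) := by ring
      _ ≤ 3 * q * (9 * (b * a)) := by gcongr
      _ = 27 * (q * (b * a)) := by ring
  · have h1 : (0 : ℝ) < Fintype.card (Fin q) := by exact_mod_cast Fintype.card_pos (α := Fin q)
    have h2 : (0 : ℝ) < Fintype.card (Fin q × (Unit ⊕ (Fin a ⊕ Fin b))) := by
      exact_mod_cast Fintype.card_pos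
    have h3 : (0 : ℝ) < Fintype.card ((Fin q × (Unit ⊕ (Fin a ⊕ Fin b))) ⊕ Fin e) := by
      exact_mod_cast Fintype.card_pos
    positivity

/-! ### Rank-one tensors and Tucker products -/

section Tensors

variable {m : ℕ} {d r : Fin m → ℕ} {I : Type*}

/-- The rank-one tensor `x₁ ⊗ ⋯ ⊗ xₘ`. -/
def rankOne (x : (k : Fin m) → Fin (d k) → ℝ) : Tensor d := fun w => ∏ k, x k (w k)

/-- The Frobenius inner product of two tensors. -/
def frobInner (S T : Tensor d) : ℝ := ∑ w, S w * T w

lemma frobInner_rankOne (x y : (k : Fin m) → Fin (d k) → ℝ) :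
    frobInner (rankOne x) (rankOne y) = ∏ k, ∑ i, x k i * y k i := by
  rw [Fintype.prod_sum]
  simp only [frobInner, rankOne, Finset.prod_mul_distrib]

lemma frobSq_eq_frobInner (T : Tensor d) : frobSq T = frobInner T T := by
  simp only [frobSq, frobInner, sq]

lemma frobSq_smul (c : ℝ) (T : Tensor d) : frobSq (c • T) = c ^ 2 * frobSq T := by
  simp [frobSq, mul_pow, Finset.mul_sum]

lemma frobSq_sum_of_orthogonal (s : Finset I) (X : I → Tensor d)
    (h : ∀ i ∈ s, ∀ j ∈ s, i ≠ j → frobInner (X i) (X j) = 0) :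
    frobSq (∑ i ∈ s, X i) = ∑ i ∈ s, frobSq (X i) := by
  have h1 : frobSq (∑ i ∈ s, X i) = ∑ i ∈ s, ∑ j ∈ s, frobInner (X i) (X j) := by
    simp only [frobSq, frobInner, Finset.sum_apply, sq, Finset.sum_mul_sum]
    rw [Finset.sum_comm]
    refine Finset.sum_congr rfl fun i _ => Finset.sum_comm
  rw [h1]
  refine Finset.sum_congr rfl fun i hi => ?_
  rw [frobSq_eq_frobInner]
  exact Finset.sum_eq_single_of_mem i hi fun j hj hji => h i hi j hj hji.symm

/-- Rank-one tensors that differ in a single factor. -/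
lemma rankOne_sub_rankOne (k : Fin m) {x y : (k : Fin m) → Fin (d k) → ℝ}
    (h : ∀ j, j ≠ k → x j = y j) :
    rankOne x - rankOne y = rankOne (Function.update x k (x k - y k)) := by
  have hsplit : ∀ (z : (k : Fin m) → Fin (d k) → ℝ) (w : Idx d),
      rankOne z w = z k (w k) * ∏ j ∈ Finset.univ.erase k, z j (w j) := fun z w =>
    (Finset.mul_prod_erase Finset.univ (fun j => z j (w j)) (Finset.mem_univ k)).symm
  funext w
  rw [Pi.sub_apply, hsplit, hsplit, hsplit, Function.update_self, Pi.sub_apply, sub_mul]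
  congr 1
  · congr 1
    refine Finset.prod_congr rfl fun j hj => ?_
    rw [Function.update_of_ne (Finset.ne_of_mem_erase hj)]
  · congr 1
    refine Finset.prod_congr rfl fun j hj => ?_
    rw [Function.update_of_ne (Finset.ne_of_mem_erase hj), h j (Finset.ne_of_mem_erase hj)]

/-- The rank-one tensor formed by the columns `l k` of the factor matrices `U k`. -/
def colTensor (U : (k : Fin m) → Matrix (Fin (d k)) (Fin (r k)) ℝ) (l : Idx r) : Tensor d :=
  rankOne fun k i => U k i (l k)

lemma tucker_mem_boundedTuckerRank (C : Tensor r)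
    (U : (k : Fin m) → Matrix (Fin (d k)) (Fin (r k)) ℝ) :
    tucker C U ∈ boundedTuckerRank d r := by
  intro k
  let M : Matrix (Fin (r k)) ((j : {j : Fin m // j ≠ k}) → Fin (d j)) ℝ :=
    of fun a w => ∑ l : Idx r, if l k = a then C l * ∏ j : {j : Fin m // j ≠ k}, U j (w j) (l j)
      else 0
  have hM : matricization k (tucker C U) = U k * M := by
    ext i w
    simp only [matricization, tucker, of_apply, mul_apply, M, Finset.mul_sum]
    rw [Finset.sum_comm]
    refine Finset.sum_congr rfl fun l _ => ?_
    simp only [mul_ite, mul_zero, Finset.sum_ite_eq, Finset.mem_univ, if_true]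
    rw [Fintype.prod_eq_mul_prod_subtype_ne _ k]
    have h1 : (Equiv.piSplitAt k fun j => Fin (d j)).symm (i, w) k = i := by
      simp [Equiv.piSplitAt]
    have h2 : ∀ j : {j : Fin m // j ≠ k},
        (Equiv.piSplitAt k fun j => Fin (d j)).symm (i, w) j = w j := fun j => by
      simp [Equiv.piSplitAt, j.2]
    simp only [h1, h2]
    ring
  rw [hM]
  exact (rank_mul_le_left _ _).trans (rank_le_width _)

/-- Linear combinations of the rank-one tensors built from columns of equal norm frames are as
incoherent as possible. -/
lemma sum_colTensor_mem {μ : ℝ} (hμ : 1 ≤ μ) (hr : ∀ k, 1 ≤ r k) (hrd : ∀ k, r k ≤ d k)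
    {U : (k : Fin m) → Matrix (Fin (d k)) (Fin (r k)) ℝ} (hU : ∀ k, IsEqualNormFrame (U k))
    (s : Finset I) (c : I → ℝ) (l : I → Idx r) :
    ∑ i ∈ s, c i • colTensor U (l i) ∈ incoherentTensors d r μ := by
  have hT : ∑ i ∈ s, c i • colTensor U (l i) =
      tucker (fun a => ∑ i ∈ s, if a = l i then c i else 0) U := by
    funext w
    simp only [Finset.sum_apply, Pi.smul_apply, smul_eq_mul, tucker, colTensor, rankOne,
      Finset.sum_mul, ite_mul, zero_mul]
    rw [Finset.sum_comm]
    refine Finset.sum_congr rfl fun i _ => ?_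
    rw [Finset.sum_ite_eq' Finset.univ (l i), if_pos (Finset.mem_univ _)]
  refine ⟨hT ▸ tucker_mem_boundedTuckerRank _ _, _, U, hT, fun k => ⟨(hU k).1, fun i => ?_⟩⟩
  have h1 : (0 : ℝ) < r k := by exact_mod_cast hr k
  have h2 : (0 : ℝ) < d k := by exact_mod_cast (hr k).trans (hrd k)
  rw [(hU k).2 i, Fintype.card_fin, Fintype.card_fin, div_mul_cancel₀ _ h2.ne', div_self h1.ne']
  exact hμ

lemma frobInner_colTensor {U : (k : Fin m) → Matrix (Fin (d k)) (Fin (r k)) ℝ}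
    (hU : ∀ k, IsEqualNormFrame (U k)) (l l' : Idx r) :
    frobInner (colTensor U l) (colTensor U l') = if l = l' then 1 else 0 := by
  rw [colTensor, colTensor, frobInner_rankOne]
  simp_rw [(hU _).inner_col]
  by_cases h : l = l'
  · subst h; simp
  · obtain ⟨k, hk⟩ := Function.ne_iff.mp h
    rw [if_neg h]
    exact Finset.prod_eq_zero (Finset.mem_univ k) (if_neg hk)

end Tensors

/-- The conclusion of the lower bound at the error level `t`: every estimator errs by at least `t`,
with probability bounded below, for some incoherent tensor and some contamination. -/
def HasRisk {m : ℕ} (d r : Fin m → ℕ) (μ σ α t : ℝ) : Prop :=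
  ∀ That : Tensor d → Tensor d, Measurable That → ∃ T ∈ incoherentTensors d r μ,
    ∃ κ : Idx d → Corruption σ, ENNReal.ofReal (1 / 100) ≤ errorProb σ α κ That T t

section Risk

variable {m : ℕ} {d r : Fin m → ℕ} {μ σ α : ℝ}

lemma HasRisk.mono {t t' : ℝ} (h : HasRisk d r μ σ α t) (ht : t' ≤ t) :
    HasRisk d r μ σ α t' := by
  intro That hT
  obtain ⟨T, hTm, κ, hκ⟩ := h That hT
  exact ⟨T, hTm, κ, hκ.trans (measure_mono fun x hx => ht.trans hx)⟩

lemma one_div_hundred_le : (1 / 100 : ℝ) ≤ 1 - Real.exp (-1 / 80) := by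
  have h : Real.exp (-1 / 80) = (Real.exp (1 / 80))⁻¹ := by rw [← Real.exp_neg]; norm_num
  have h1 : (81 / 80 : ℝ) ≤ Real.exp (1 / 80) := by
    have := Real.add_one_le_exp (1 / 80 : ℝ)
    linarith
  have h2 : (Real.exp (1 / 80))⁻¹ ≤ (81 / 80 : ℝ)⁻¹ := inv_anti₀ (by norm_num) h1
  rw [h]
  norm_num at h2 ⊢
  linarith

/-- The risk of a cube of incoherent tensors. -/
lemma hasRisk_of_cube {I : Type*} [Fintype I] [DecidableEq I] [Nonempty I] {s K : ℝ} (hσ : 0 < σ)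
    (h0 : 0 < α) (h1 : α < 1) (T : (I → Bool) → Tensor d)
    (hTm : ∀ v, T v ∈ incoherentTensors d r μ) (hs : 0 < s) (hK : 10 * (K * s) ≤ σ ^ 2)
    (hlow : ∀ u v, s * hammingDist u v ≤ frobSq (T u - T v))
    (hup : ∀ u v, frobSq (T u - T v) ≤ K * s * hammingDist u v) :
    HasRisk d r μ σ α (s * Fintype.card I / 32) := by
  intro That hT
  obtain ⟨v, hv⟩ := exists_errorProb_of_cube hσ h0.le h1.le hT T hs hK hlow hup
  refine ⟨T v, hTm v, _, le_trans (ENNReal.ofReal_le_ofReal ?_) hv⟩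
  refine one_div_hundred_le.trans (sub_le_sub_left (Real.exp_le_exp.mpr ?_) 1)
  norm_num

/-! ### The contamination term -/

/-- The lower bound for the contamination term; the construction yields the bound without
the factor `μ ^ m` in the denominator, which is stronger. -/
lemma hasRisk_contamination (hμ : 1 ≤ μ) (hr : ∀ k, 1 ≤ r k) (hrd : ∀ k, r k ≤ d k)
    (hσ : 0 < σ) (h0 : 0 < α) (h1 : α < 1) :
    HasRisk d r μ σ α (σ ^ 2 * (α ^ 2 * (∏ k, (d k : ℝ)) / (μ ^ m * ∏ k, (r k : ℝ))) / 8) := by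
  choose U hU using fun k => exists_isEqualNormFrame (d k) (r k) (hr k) (hrd k)
  have hrpos : ∀ k, (0 : ℝ) < r k := fun k => by exact_mod_cast hr k
  have hdpos : ∀ k, (0 : ℝ) < d k := fun k => by exact_mod_cast (hr k).trans (hrd k)
  have hR : 0 < ∏ k, (r k : ℝ) := Finset.prod_pos fun k _ => hrpos k
  have hD : 0 < ∏ k, (d k : ℝ) := Finset.prod_pos fun k _ => hdpos k
  let l : Idx r := fun k => ⟨0, hr k⟩
  -- the largest multiple of a unit rank-one tensor whose entries are at most `α σ / √2`
  set q : ℝ := σ ^ 2 * (α ^ 2 * (∏ k, (d k : ℝ)) / ∏ k, (r k : ℝ)) / 2 with hq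
  have hq0 : 0 ≤ q := by positivity
  set T : Tensor d := √q • colTensor U l with hT
  have hcol : frobSq (colTensor U l) = 1 := by
    rw [frobSq_eq_frobInner, frobInner_colTensor hU, if_pos rfl]
  have hTsq : frobSq T = q := by rw [hT, frobSq_smul, hcol, mul_one, Real.sq_sqrt hq0]
  have hmem : ∀ c : ℝ, c • colTensor U l ∈ incoherentTensors d r μ := fun c => by
    simpa using sum_colTensor_mem hμ hr hrd hU ({()} : Finset Unit) (fun _ => c) fun _ => l
  have hsup : ∀ w, 2 * T w ^ 2 ≤ α ^ 2 * σ ^ 2 := fun w => by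
    have h2 : colTensor U l w ^ 2 ≤ (∏ k, (r k : ℝ)) / ∏ k, (d k : ℝ) := by
      rw [colTensor, rankOne, ← Finset.prod_pow, ← Finset.prod_div_distrib]
      refine Finset.prod_le_prod (fun _ _ => sq_nonneg _) fun k _ => ?_
      simpa using (hU k).sq_le (w k) (l k)
    rw [hT, Pi.smul_apply, smul_eq_mul, mul_pow, Real.sq_sqrt hq0]
    calc 2 * (q * colTensor U l w ^ 2) ≤ 2 * (q * ((∏ k, (r k : ℝ)) / ∏ k, (d k : ℝ))) := by gcongr
      _ = α ^ 2 * σ ^ 2 := by rw [hq]; field_simp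
  have hle : σ ^ 2 * (α ^ 2 * (∏ k, (d k : ℝ)) / (μ ^ m * ∏ k, (r k : ℝ))) / 8 ≤ q / 4 := by
    have : α ^ 2 * (∏ k, (d k : ℝ)) / (μ ^ m * ∏ k, (r k : ℝ)) ≤
        α ^ 2 * (∏ k, (d k : ℝ)) / ∏ k, (r k : ℝ) := by
      gcongr
      exact le_mul_of_one_le_left hR.le (one_le_pow₀ hμ)
    rw [hq]
    have := mul_le_mul_of_nonneg_left this (sq_nonneg σ)
    linarith
  refine HasRisk.mono (fun That hThat => ?_) hle
  obtain ⟨S, hS, κ, hκ⟩ := exists_errorProb_of_spread (t := q / 4) hσ h0 h1.le hThat T hsup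
    (by rw [hTsq]; linarith)
  refine ⟨S, ?_, κ, le_trans (ENNReal.ofReal_le_ofReal (by norm_num)) hκ⟩
  rcases hS with rfl | rfl
  · exact hmem _
  · simpa using hmem 0

/-! ### The degrees of freedom of the core tensor -/

/-- With fixed factors, the core tensor runs through a cube isometrically. -/
lemma hasRisk_core (hμ : 1 ≤ μ) (hr : ∀ k, 1 ≤ r k) (hrd : ∀ k, r k ≤ d k)
    (hσ : 0 < σ) (h0 : 0 < α) (h1 : α < 1) :
    HasRisk d r μ σ α (σ ^ 2 * (∏ k, (r k : ℝ)) / 320) := by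
  choose U hU using fun k => exists_isEqualNormFrame (d k) (r k) (hr k) (hrd k)
  have : Nonempty (Idx r) := ⟨fun k => ⟨0, hr k⟩⟩
  set s := σ ^ 2 / 10 with hs
  let T : (Idx r → Bool) → Tensor d := fun v =>
    ∑ l, (if v l then √s else 0) • colTensor U l
  have hdist : ∀ u v, frobSq (T u - T v) = s * hammingDist u v := fun u v => by
    simp only [T, ← Finset.sum_sub_distrib, ← sub_smul]
    rw [frobSq_sum_of_orthogonal, hammingDist_eq_sum, Finset.mul_sum]
    · refine Finset.sum_congr rfl fun l _ => ?_
      rw [frobSq_smul, frobSq_eq_frobInner, frobInner_colTensor hU, if_pos rfl, mul_one]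
      have hsq : √s ^ 2 = s := Real.sq_sqrt (by positivity)
      by_cases hu : u l <;> by_cases hv : v l <;> simp [hu, hv, hsq]
    · intro l _ l' _ hne
      have : frobInner (colTensor U l) (colTensor U l') = 0 := by
        rw [frobInner_colTensor hU, if_neg hne]
      simp only [frobInner, Pi.smul_apply, smul_eq_mul] at this ⊢
      simp_rw [mul_mul_mul_comm, ← Finset.mul_sum]
      rw [this, mul_zero]
  have := hasRisk_of_cube (μ := μ) (r := r) (s := s) (K := 1) hσ h0 h1 T
    (fun v => sum_colTensor_mem hμ hr hrd hU _ _ _) (by positivity) (by rw [hs]; linarith)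
    (fun u v => (hdist u v).ge) (fun u v => by rw [hdist, one_mul])
  refine this.mono (le_of_eq ?_)
  rw [hs, Fintype.card_pi]
  simp only [Fintype.card_fin]
  push_cast
  ring

end Risk

/-! ### The degrees of freedom of factors of large rank -/

section Factors

variable {m : ℕ} {d r : Fin m → ℕ} {μ σ α : ℝ}

lemma isFrameCube_const {ι κ : Type*} [Fintype ι] [Fintype κ] [DecidableEq κ] {U : Matrix ι κ ℝ}
    (hU : IsEqualNormFrame U) (k : κ) (s : ℝ) : IsFrameCube (I := Fin 0) k s fun _ => U := by
  refine ⟨fun _ => hU, fun _ _ _ => rfl, fun u v => ?_, fun u v => ?_⟩ <;>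
    simp [matSq, hammingDist]

/-- Let the factors of the modes in `K` vary, each keeping its column `0`. If the multi-index
`l k a` of the core has `k`-th coordinate `a` and vanishes at the other modes of `K`, then the rank-one
terms depend on one varying factor each, and if in addition the `l k a`, for fixed `k`, are separated
by modes outside `K`, the changes of these terms are orthogonal. -/
lemma frobInner_colTensor_sub {K : Finset (Fin m)} {o : Idx r} {l : (k : Fin m) → Fin (r k) → Idx r}
    (hl₁ : ∀ k ∈ K, ∀ a, l k a k = a) (hl₂ : ∀ k ∈ K, ∀ a, ∀ j ∈ K, j ≠ k → l k a j = o j)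
    (hl₃ : ∀ k ∈ K, ∀ a a', a ≠ a' → ∃ j ∉ K, l k a j ≠ l k a' j)
    {U V : (k : Fin m) → Matrix (Fin (d k)) (Fin (r k)) ℝ} (hU : ∀ k, IsEqualNormFrame (U k))
    (hV : ∀ k, IsEqualNormFrame (V k)) (hcol : ∀ k i, U k i (o k) = V k i (o k))
    (hUV : ∀ k ∉ K, U k = V k) {k : Fin m} (hk : k ∈ K) (a : Fin (r k)) {k' : Fin m} (hk' : k' ∈ K)
    (a' : Fin (r k')) :
    frobInner (colTensor U (l k a) - colTensor V (l k a))
      (colTensor U (l k' a') - colTensor V (l k' a')) =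
      if (⟨k, a⟩ : Σ k, Fin (r k)) = ⟨k', a'⟩ then ∑ i, (U k i a - V k i a) ^ 2 else 0 := by
  have hagree : ∀ k ∈ K, ∀ a, ∀ j, j ≠ k → (fun i => U j i (l k a j)) = fun i => V j i (l k a j) := by
    intro k hk a j hj
    funext i
    by_cases hjK : j ∈ K
    · rw [hl₂ k hk a j hjK hj, hcol]
    · rw [hUV j hjK]
  have hsub : ∀ k ∈ K, ∀ a, colTensor U (l k a) - colTensor V (l k a) =
      rankOne (Function.update (fun j i => U j i (l k a j)) k fun i => U k i a - V k i a) := by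
    intro k hk a
    rw [colTensor, colTensor, rankOne_sub_rankOne k (hagree k hk a), hl₁ k hk a]
    rfl
  rw [hsub k hk a, hsub k' hk' a', frobInner_rankOne]
  by_cases hkk : k = k'
  · subst hkk
    by_cases haa : a = a'
    · subst haa
      rw [if_pos rfl, Finset.prod_eq_single_of_mem k (Finset.mem_univ k)]
      · simp [sq]
      · intro j _ hj
        simp only [Function.update_of_ne hj]
        rw [(hU j).inner_col, if_pos rfl]
    · rw [if_neg (by simpa using haa)]
      obtain ⟨j, hjK, hj⟩ := hl₃ k hk a a' haa
      have hjk : j ≠ k := fun h => hjK (h ▸ hk)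
      refine Finset.prod_eq_zero (Finset.mem_univ j) ?_
      simp only [Function.update_of_ne hjk]
      rw [(hU j).inner_col, if_neg hj]
  · rw [if_neg fun h => hkk (congrArg Sigma.fst h)]
    refine Finset.prod_eq_zero (Finset.mem_univ k) ?_
    simp only [Function.update_of_ne hkk, Function.update_self]
    rw [hl₂ k' hk' a' k hk hkk]
    -- both `U k` and `V k` have orthonormal columns and share the column `o k`
    simp_rw [sub_mul, Finset.sum_sub_distrib]
    have : ∑ i, V k i a * U k i (o k) = ∑ i, V k i a * V k i (o k) :=
      Finset.sum_congr rfl fun i _ => by rw [hcol]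
    rw [this, (hU k).inner_col, (hV k).inner_col, sub_self]

/-- The cubes of frames of the modes in `K` combine to one cube of tensors, for a core supported on
the multi-indices `l k a`. -/
lemma hasRisk_factors (hμ : 1 ≤ μ) (hr : ∀ k, 1 ≤ r k) (hrd : ∀ k, r k ≤ d k) (hσ : 0 < σ)
    (h0 : 0 < α) (h1 : α < 1) {K : Finset (Fin m)} (hK : ∀ k ∈ K, 3 ≤ r k ∧ 2 * r k ≤ d k)
    (l : (k : Fin m) → Fin (r k) → Idx r) (hl₁ : ∀ k ∈ K, ∀ a, l k a k = a)
    (hl₂ : ∀ k ∈ K, ∀ a, ∀ j ∈ K, j ≠ k → l k a j = ⟨0, hr j⟩)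
    (hl₃ : ∀ k ∈ K, ∀ a a', a ≠ a' → ∃ j ∉ K, l k a j ≠ l k a' j) :
    HasRisk d r μ σ α (σ ^ 2 * (∑ k ∈ K, (d k * r k : ℝ)) / 699840) := by
  rcases K.eq_empty_or_nonempty with rfl | ⟨k₀, hk₀⟩
  · refine (hasRisk_core hμ hr hrd hσ h0 h1).mono ?_
    rw [Finset.sum_empty, mul_zero, zero_div]
    positivity
  let o : Idx r := fun k => ⟨0, hr k⟩
  have hfam : ∀ k, ∃ (N : ℕ) (s : ℝ) (U : (Fin N → Bool) → Matrix (Fin (d k)) (Fin (r k)) ℝ),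
      (k ∈ K → d k * r k ≤ 27 * N) ∧ (k ∉ K → N = 0) ∧ 0 < s ∧ IsFrameCube (o k) s U := by
    intro k
    by_cases hk : k ∈ K
    · obtain ⟨N, s, U, hN, hs, hU⟩ := exists_isFrameCube (hK k hk).1 (hK k hk).2 (o k)
      exact ⟨N, s, U, fun _ => hN, fun h => absurd hk h, hs, hU⟩
    · obtain ⟨U, hU⟩ := exists_isEqualNormFrame (d k) (r k) (hr k) (hrd k)
      exact ⟨0, 1, _, fun h => absurd h hk, fun _ => rfl, one_pos, isFrameCube_const hU (o k) 1⟩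
  choose N s U hNK hN0 hs hU using hfam
  let F : ((Σ k, Fin (N k)) → Bool) → (k : Fin m) → Matrix (Fin (d k)) (Fin (r k)) ℝ :=
    fun v k => U k fun i => v ⟨k, i⟩
  set S := σ ^ 2 / 810 with hS
  have hSpos : 0 < S := by positivity
  let P : Finset (Σ k, Fin (r k)) := K.sigma fun _ => Finset.univ
  -- the weights of the core compensate for the different scales of the cubes of frames
  let T : ((Σ k, Fin (N k)) → Bool) → Tensor d := fun v =>
    ∑ p ∈ P, √(S / s p.1) • colTensor (F v) (l p.1 p.2)
  have hFout : ∀ u v, ∀ k ∉ K, F u k = F v k := fun u v k hk => by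
    have : IsEmpty (Fin (N k)) := by rw [hN0 k hk]; infer_instance
    simp only [F]
    congr 1
    exact Subsingleton.elim _ _
  have hdist : ∀ u v, frobSq (T u - T v) = ∑ k ∈ K, S / s k * matSq (F u k - F v k) := by
    intro u v
    have hin : ∀ p ∈ P, ∀ p' ∈ P, frobInner (colTensor (F u) (l p.1 p.2) - colTensor (F v) (l p.1 p.2))
        (colTensor (F u) (l p'.1 p'.2) - colTensor (F v) (l p'.1 p'.2)) =
        if p = p' then ∑ i, (F u p.1 i p.2 - F v p.1 i p.2) ^ 2 else 0 := by
      rintro ⟨k, a⟩ hp ⟨k', a'⟩ hp'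
      exact frobInner_colTensor_sub (o := o) hl₁ hl₂ hl₃ (fun k => (hU k).frame _)
        (fun k => (hU k).frame _) (fun k i => (hU k).col_eq _ _ i) (hFout u v)
        (Finset.mem_sigma.mp hp).1 a (Finset.mem_sigma.mp hp').1 a'
    simp only [T, ← Finset.sum_sub_distrib, ← smul_sub]
    rw [frobSq_sum_of_orthogonal]
    · rw [Finset.sum_sigma]
      refine Finset.sum_congr rfl fun k hk => ?_
      rw [matSq, Finset.sum_comm, Finset.mul_sum]
      refine Finset.sum_congr rfl fun a _ => ?_
      have hp : (⟨k, a⟩ : Σ k, Fin (r k)) ∈ P := Finset.mem_sigma.mpr ⟨hk, Finset.mem_univ a⟩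
      have hsk := hs k
      rw [frobSq_smul, frobSq_eq_frobInner, hin _ hp _ hp, if_pos rfl,
        Real.sq_sqrt (by positivity)]
      rfl
    · intro p hp p' hp' hne
      have := hin p hp p' hp'
      rw [if_neg hne] at this
      simp only [frobInner, Pi.smul_apply, smul_eq_mul] at this ⊢
      simp_rw [mul_mul_mul_comm, ← Finset.mul_sum]
      rw [this, mul_zero]
  have hham : ∀ u v : (Σ k, Fin (N k)) → Bool, (hammingDist u v : ℝ) =
      ∑ k ∈ K, (hammingDist (fun i => u ⟨k, i⟩) (fun i => v ⟨k, i⟩) : ℝ) := by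
    intro u v
    rw [hammingDist_eq_sum, Fintype.sum_sigma]
    simp only [hammingDist_eq_sum]
    refine (Finset.sum_subset (Finset.subset_univ K) fun k _ hk => ?_).symm
    have : IsEmpty (Fin (N k)) := by rw [hN0 k hk]; infer_instance
    exact Fintype.sum_empty _
  have hcard : ∑ k ∈ K, (d k * r k : ℝ) ≤ 27 * Fintype.card (Σ k, Fin (N k)) := by
    rw [Fintype.card_sigma]
    push_cast
    simp only [Fintype.card_fin]
    rw [Finset.mul_sum]
    calc ∑ k ∈ K, (d k * r k : ℝ) ≤ ∑ k ∈ K, 27 * (N k : ℝ) :=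
          Finset.sum_le_sum fun k hk => by exact_mod_cast hNK k hk
      _ ≤ _ := Finset.sum_le_sum_of_subset_of_nonneg (Finset.subset_univ _) fun _ _ _ => by
          positivity
  have hne : Nonempty (Σ k, Fin (N k)) := by
    have h2 := hNK k₀ hk₀
    have h3 : 0 < d k₀ * r k₀ := Nat.mul_pos ((hr k₀).trans (hrd k₀)) (hr k₀)
    exact ⟨⟨k₀, ⟨0, by omega⟩⟩⟩
  have hlow : ∀ u v, S * hammingDist u v ≤ frobSq (T u - T v) := fun u v => by
    rw [hdist, hham, Finset.mul_sum]
    refine Finset.sum_le_sum fun k _ => ?_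
    have hsk := hs k
    have := mul_le_mul_of_nonneg_left ((hU k).le_matSq (fun i => u ⟨k, i⟩) fun i => v ⟨k, i⟩)
      (show 0 ≤ S / s k by positivity)
    rwa [← mul_assoc, div_mul_cancel₀ _ hsk.ne'] at this
  have hup : ∀ u v, frobSq (T u - T v) ≤ 81 * S * hammingDist u v := fun u v => by
    rw [hdist, hham, Finset.mul_sum]
    refine Finset.sum_le_sum fun k _ => ?_
    have hsk := hs k
    have := mul_le_mul_of_nonneg_left ((hU k).matSq_le (fun i => u ⟨k, i⟩) fun i => v ⟨k, i⟩)
      (show 0 ≤ S / s k by positivity)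
    rwa [← mul_assoc, mul_left_comm, div_mul_cancel₀ _ hsk.ne'] at this
  have hTm : ∀ v, T v ∈ incoherentTensors d r μ := fun v =>
    sum_colTensor_mem hμ hr hrd (fun k => (hU k).frame _) P (fun p => √(S / s p.1))
      fun p => l p.1 p.2
  refine (hasRisk_of_cube hσ h0 h1 T hTm hSpos (by rw [hS]; linarith) hlow hup).mono ?_
  have := mul_le_mul_of_nonneg_left hcard (sq_nonneg σ)
  rw [hS]
  linarith

/-- The case of a single mode `k₀`: the core has `r k₀` entries, with distinct positions in the
other modes. -/
lemma hasRisk_factor (hμ : 1 ≤ μ) (hr : ∀ k, 1 ≤ r k) (hrd : ∀ k, r k ≤ d k) (hσ : 0 < σ)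
    (h0 : 0 < α) (h1 : α < 1) {k₀ : Fin m} (hk₀ : 3 ≤ r k₀ ∧ 2 * r k₀ ≤ d k₀)
    (hprod : r k₀ ≤ ∏ j ∈ Finset.univ.erase k₀, r j) :
    HasRisk d r μ σ α (σ ^ 2 * (d k₀ * r k₀ : ℝ) / 699840) := by
  have hcard : Fintype.card (Fin (r k₀)) ≤
      Fintype.card ((j : {j : Fin m // j ≠ k₀}) → Fin (r j)) := by
    rw [Fintype.card_pi]
    simp only [Fintype.card_fin]
    rwa [Finset.prod_subtype (Finset.univ.erase k₀) (p := fun j => j ≠ k₀)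
      (fun j => by simp)] at hprod
  obtain ⟨φ⟩ := Function.Embedding.nonempty_of_card_le hcard
  let t : Fin (r k₀) → Idx r := fun a => (Equiv.piSplitAt k₀ fun j => Fin (r j)).symm (a, φ a)
  have ht₁ : ∀ a, t a k₀ = a := fun a => by simp [t, Equiv.piSplitAt]
  have ht₂ : ∀ a (j : {j : Fin m // j ≠ k₀}), t a j = φ a j := fun a j => by
    simp [t, Equiv.piSplitAt, j.2]
  let l : (k : Fin m) → Fin (r k) → Idx r := fun k a =>
    if h : k = k₀ then t (h ▸ a) else fun j => ⟨0, hr j⟩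
  have hl : ∀ a, l k₀ a = t a := fun a => by simp [l]
  have := hasRisk_factors hμ hr hrd hσ h0 h1 (K := {k₀}) (by simpa using hk₀) l
    (fun k hk a => by
      obtain rfl := Finset.mem_singleton.mp hk
      rw [hl, ht₁])
    (fun k hk a j hj hjk => by
      rw [Finset.mem_singleton] at hk hj
      exact absurd (hj.trans hk.symm) hjk)
    (fun k hk a a' haa => by
      obtain rfl := Finset.mem_singleton.mp hk
      obtain ⟨j, hj⟩ := Function.ne_iff.mp (φ.injective.ne haa)
      refine ⟨j, by simpa using j.2, ?_⟩
      rw [hl, hl, ht₂, ht₂]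
      exact hj)
  simpa using this

/-- The case of all modes but the one of largest rank, whose coordinate separates the entries of the
core that belong to one mode. -/
lemma hasRisk_factors_erase (hμ : 1 ≤ μ) (hr : ∀ k, 1 ≤ r k) (hrd : ∀ k, r k ≤ d k) (hσ : 0 < σ)
    (h0 : 0 < α) (h1 : α < 1) {k₀ : Fin m} (hmax : ∀ k, r k ≤ r k₀) {K : Finset (Fin m)}
    (hk₀ : k₀ ∉ K) (hK : ∀ k ∈ K, 3 ≤ r k ∧ 2 * r k ≤ d k) :
    HasRisk d r μ σ α (σ ^ 2 * (∑ k ∈ K, (d k * r k : ℝ)) / 699840) := by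
  refine hasRisk_factors hμ hr hrd hσ h0 h1 hK
    (fun k a => Function.update
      (Function.update (fun j => ⟨0, hr j⟩) k₀ (Fin.castLE (hmax k) a)) k a)
    (fun k _ a => Function.update_self ..) (fun k _ a j hj hjk => ?_) fun k hk a a' haa => ?_
  · have : j ≠ k₀ := fun h => hk₀ (h ▸ hj)
    rw [Function.update_of_ne hjk, Function.update_of_ne this]
  · have : k₀ ≠ k := fun h => hk₀ (h ▸ hk)
    refine ⟨k₀, hk₀, ?_⟩
    rw [Function.update_of_ne this, Function.update_of_ne this, Function.update_self,
      Function.update_self]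
    exact fun h => haa (Fin.castLE_injective _ h)

end Factors

/-! ### The degrees of freedom of factors of rank one or two -/

/-- The sign encoded by a bit. -/
def bsign (c : Bool) : ℝ := if c then 1 else -1

lemma bsign_mul_self (c : Bool) : bsign c * bsign c = 1 := by cases c <;> simp [bsign]

lemma abs_bsign (c : Bool) : |bsign c| = 1 := by cases c <;> simp [bsign]

/-- The generating function of a weighted sum of independent signs. -/
lemma sum_exp_bsign {n : ℕ} (x : Fin n → ℝ) :
    ∑ ε : Fin n → Bool, Real.exp (∑ i, bsign (ε i) * x i) ≤
      2 ^ n * Real.exp ((∑ i, x i ^ 2) / 2) := by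
  simp_rw [Real.exp_sum]
  rw [← Fintype.prod_sum (fun i (c : Bool) => Real.exp (bsign c * x i)), Finset.sum_div,
    Real.exp_sum]
  have : (2 : ℝ) ^ n = ∏ _i : Fin n, 2 := by simp
  rw [this, ← Finset.prod_mul_distrib]
  refine Finset.prod_le_prod (fun i _ => by positivity) fun i _ => ?_
  have := Real.cosh_le_exp_half_sq (x i)
  rw [Real.cosh_eq] at this
  simp only [Fintype.sum_bool, bsign, if_true, Bool.false_eq_true, if_false, one_mul, neg_mul]
  linarith

/-- Hoeffding's inequality for an average of signs with weights at most `1 / D ≤ 1 / 2`. -/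
lemma card_abs_sign_sum_gt_le {n : ℕ} {D : ℝ} (hD : 2 ≤ D) {w : Fin n → ℝ} (hw0 : ∀ i, 0 ≤ w i)
    (hw1 : ∑ i, w i = 1) (hwD : ∀ i, w i ≤ 1 / D) (ε₀ : Fin n → Bool) :
    ∑ ε : Fin n → Bool, (if 19 / 20 < |∑ i, bsign (ε i) * (bsign (ε₀ i) * w i)| then (1 : ℝ) else 0) ≤
      2 ^ n * Real.exp (-D / 10) := by
  have hDpos : 0 < D := by linarith
  -- the optimal exponent in the Chernoff bound
  set s : ℝ := 19 / 20 * D with hs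
  have hs0 : 0 < s := by positivity
  let z : (Fin n → Bool) → ℝ := fun ε => ∑ i, bsign (ε i) * (bsign (ε₀ i) * w i)
  have hsq : ∀ c : ℝ, c ^ 2 = s ^ 2 → ∑ i, (c * (bsign (ε₀ i) * w i)) ^ 2 ≤ s ^ 2 / D := by
    intro c hc
    calc ∑ i, (c * (bsign (ε₀ i) * w i)) ^ 2 = s ^ 2 * ∑ i, w i ^ 2 := by
          rw [Finset.mul_sum]
          refine Finset.sum_congr rfl fun i _ => ?_
          rw [mul_pow, mul_pow, hc, sq (bsign _), bsign_mul_self, one_mul]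
      _ ≤ s ^ 2 * ∑ i, 1 / D * w i := by
          gcongr with i
          rw [sq]
          exact mul_le_mul_of_nonneg_right (hwD i) (hw0 i)
      _ = s ^ 2 / D := by rw [← Finset.mul_sum, hw1]; ring
  have hmgf : ∀ c : ℝ, c ^ 2 = s ^ 2 →
      ∑ ε, Real.exp (c * z ε) ≤ 2 ^ n * Real.exp (s ^ 2 / D / 2) := by
    intro c hc
    have : ∀ ε, c * z ε = ∑ i, bsign (ε i) * (c * (bsign (ε₀ i) * w i)) := fun ε => by
      rw [Finset.mul_sum]
      exact Finset.sum_congr rfl fun i _ => by ring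
    simp_rw [this]
    refine (sum_exp_bsign _).trans ?_
    gcongr
    exact hsq c hc
  calc ∑ ε : Fin n → Bool, (if 19 / 20 < |z ε| then (1 : ℝ) else 0)
      ≤ ∑ ε, Real.exp (-(19 / 20 * s)) * (Real.exp (s * z ε) + Real.exp (-s * z ε)) := by
        refine Finset.sum_le_sum fun ε _ => ?_
        split_ifs with h
        · rw [mul_add, ← Real.exp_add, ← Real.exp_add]
          rcases lt_abs.mp h with h | h
          · have : 1 ≤ Real.exp (-(19 / 20 * s) + s * z ε) := Real.one_le_exp (by nlinarith)
            have := Real.exp_pos (-(19 / 20 * s) + -s * z ε)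
            linarith
          · have : 1 ≤ Real.exp (-(19 / 20 * s) + -s * z ε) := Real.one_le_exp (by nlinarith)
            have := Real.exp_pos (-(19 / 20 * s) + s * z ε)
            linarith
        · positivity
    _ = Real.exp (-(19 / 20 * s)) * (∑ ε, Real.exp (s * z ε) + ∑ ε, Real.exp (-s * z ε)) := by
        rw [← Finset.mul_sum, Finset.sum_add_distrib]
    _ ≤ Real.exp (-(19 / 20 * s)) *
          (2 ^ n * Real.exp (s ^ 2 / D / 2) + 2 ^ n * Real.exp (s ^ 2 / D / 2)) := by
        gcongr
        · exact hmgf s rfl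
        · exact hmgf (-s) (neg_sq s)
    _ = 2 ^ n * (2 * Real.exp (-(19 / 20 * s) + s ^ 2 / D / 2)) := by
        rw [Real.exp_add]; ring
    _ ≤ 2 ^ n * (Real.exp (7 / 20 * D) * Real.exp (-(19 / 20 * s) + s ^ 2 / D / 2)) := by
        gcongr
        have h2 : Real.exp (Real.log 2) ≤ Real.exp (7 / 20 * D) :=
          Real.exp_le_exp.mpr (by linarith [Real.log_two_lt_d9])
        rwa [Real.exp_log two_pos] at h2
    _ ≤ 2 ^ n * Real.exp (-D / 10) := by
        rw [← Real.exp_add]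
        gcongr
        have : s ^ 2 / D = 361 / 400 * D := by rw [hs]; field_simp; ring
        rw [this, hs]
        linarith

lemma IsEqualNormFrame.flip {ι κ : Type*} [Fintype ι] [Fintype κ] [DecidableEq κ]
    {U : Matrix ι κ ℝ} (hU : IsEqualNormFrame U) (ε : ι → Bool) :
    IsEqualNormFrame (of fun i l => bsign (ε i) * U i l) := by
  refine ⟨?_, fun i => ?_⟩
  · rw [transpose_mul_self_eq_one_iff]
    intro a b
    rw [← hU.inner_col a b]
    refine Finset.sum_congr rfl fun i _ => ?_
    rw [of_apply, of_apply, mul_mul_mul_comm, bsign_mul_self, one_mul]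
  · rw [← hU.2 i]
    refine Finset.sum_congr rfl fun l _ => ?_
    rw [of_apply, mul_pow, sq (bsign _), bsign_mul_self, one_mul]

section Signs

variable {m : ℕ} {d r : Fin m → ℕ} {μ σ α : ℝ}

/-- Independent sign flips of the rows of all factors of a rank-one tensor: the inner product of two
such tensors is a product of averages of signs, which is close to `1` only if all its factors are. -/
lemma hasRisk_signs (hμ : 1 ≤ μ) (hr : ∀ k, 1 ≤ r k) (hrd : ∀ k, r k ≤ d k) (hσ : 0 < σ)
    (h0 : 0 < α) (h1 : α < 1) {K : Finset (Fin m)} (hK : ∀ k ∈ K, r k ≤ 2 ∧ 2 * r k ≤ d k) :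
    HasRisk d r μ σ α (σ ^ 2 * (∑ k ∈ K, (d k * r k : ℝ)) / 3200) := by
  rcases K.eq_empty_or_nonempty with rfl | ⟨k₀, hk₀⟩
  · refine (hasRisk_core hμ hr hrd hσ h0 h1).mono ?_
    rw [Finset.sum_empty, mul_zero, zero_div]
    positivity
  choose U hU using fun k => exists_isEqualNormFrame (d k) (r k) (hr k) (hrd k)
  let o : Idx r := fun k => ⟨0, hr k⟩
  let w : (k : Fin m) → Fin (d k) → ℝ := fun k i => U k i (o k) ^ 2
  have hw1 : ∀ k, ∑ i, w k i = 1 := fun k => by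
    have := (hU k).inner_col (o k) (o k)
    rw [if_pos rfl] at this
    rw [← this]
    exact Finset.sum_congr rfl fun i _ => sq _
  set A : ℝ := ∑ k ∈ K, (d k * r k : ℝ) with hA
  have hA2 : 2 ≤ A := by
    have h2 : (2 : ℝ) ≤ d k₀ * r k₀ := by
      have h3 := hr k₀
      have h4 : 2 ≤ d k₀ * r k₀ := by nlinarith [(hK k₀ hk₀).2]
      exact_mod_cast h4
    refine h2.trans ?_
    exact Finset.single_le_sum (f := fun k => (d k * r k : ℝ)) (fun k _ => by positivity) hk₀
  set q : ℝ := σ ^ 2 * (A / 80) with hq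
  have hq0 : 0 < q := by positivity
  let F : ((k : Fin m) → Fin (d k) → Bool) → (k : Fin m) → Matrix (Fin (d k)) (Fin (r k)) ℝ :=
    fun ε k => of fun i a => bsign (ε k i) * U k i a
  have hF : ∀ ε k, IsEqualNormFrame (F ε k) := fun ε k => (hU k).flip (ε k)
  let T : ((k : Fin m) → Fin (d k) → Bool) → Tensor d := fun ε => √q • colTensor (F ε) o
  have hTm : ∀ ε, T ε ∈ incoherentTensors d r μ := fun ε => by
    simpa using sum_colTensor_mem hμ hr hrd (hF ε) ({()} : Finset Unit) (fun _ => √q) fun _ => o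
  have hone : ∀ ε, frobInner (colTensor (F ε) o) (colTensor (F ε) o) = 1 := fun ε => by
    rw [frobInner_colTensor (hF ε), if_pos rfl]
  have hTsq : ∀ ε, frobSq (T ε) = q := fun ε => by
    rw [frobSq_smul, frobSq_eq_frobInner, hone, mul_one, Real.sq_sqrt hq0.le]
  let z : ((k : Fin m) → Fin (d k) → Bool) → (k : Fin m) → (Fin (d k) → Bool) → ℝ :=
    fun ε₀ k c => ∑ i, bsign (c i) * (bsign (ε₀ k i) * w k i)
  have hin : ∀ ε₀ ε, frobInner (colTensor (F ε₀) o) (colTensor (F ε) o) = ∏ k, z ε₀ k (ε k) := by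
    intro ε₀ ε
    rw [colTensor, colTensor, frobInner_rankOne]
    refine Finset.prod_congr rfl fun k _ => Finset.sum_congr rfl fun i _ => ?_
    simp only [F, w, of_apply]
    ring
  have hdist : ∀ ε₀ ε, frobSq (T ε₀ - T ε) = 2 * q * (1 - ∏ k, z ε₀ k (ε k)) := by
    intro ε₀ ε
    have hexp : ∀ S S' : Tensor d, frobSq (S - S') =
        frobInner S S + frobInner S' S' - 2 * frobInner S S' := fun S S' => by
      simp only [frobSq, frobInner, Finset.mul_sum]
      rw [← Finset.sum_add_distrib, ← Finset.sum_sub_distrib]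
      refine Finset.sum_congr rfl fun x _ => ?_
      rw [Pi.sub_apply]
      ring
    rw [show T ε₀ - T ε = √q • (colTensor (F ε₀) o - colTensor (F ε) o) from (smul_sub _ _ _).symm,
      frobSq_smul, Real.sq_sqrt hq0.le, hexp, hone, hone, hin]
    ring
  have hz1 : ∀ ε₀ k c, |z ε₀ k c| ≤ 1 := fun ε₀ k c => by
    refine (Finset.abs_sum_le_sum_abs _ _).trans (le_of_eq ?_)
    rw [← hw1 k]
    refine Finset.sum_congr rfl fun i _ => ?_
    rw [abs_mul, abs_mul, abs_bsign, abs_bsign, one_mul, one_mul, abs_of_nonneg (sq_nonneg _)]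
  have hcount : ∀ ε₀ k, k ∈ K → ∑ c, (if 19 / 20 < |z ε₀ k c| then (1 : ℝ) else 0) ≤
      2 ^ d k * Real.exp (-(d k * r k / 40 : ℝ)) := by
    intro ε₀ k hk
    have hr1 : (1 : ℝ) ≤ r k := by exact_mod_cast hr k
    have hr2 : (r k : ℝ) ≤ 2 := by exact_mod_cast (hK k hk).1
    have hd2 : 2 * (r k : ℝ) ≤ d k := by exact_mod_cast (hK k hk).2
    have hrpos : (0 : ℝ) < r k := by linarith
    have hD : (2 : ℝ) ≤ d k / r k := by rwa [le_div_iff₀ hrpos]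
    refine (card_abs_sign_sum_gt_le hD (fun i => sq_nonneg _) (hw1 k) (fun i => ?_) (ε₀ k)).trans ?_
    · rw [one_div_div]
      simpa using (hU k).sq_le i (o k)
    · gcongr
      have : (d k * r k : ℝ) / 4 ≤ d k / r k := by
        rw [le_div_iff₀ hrpos]
        have : (r k : ℝ) * r k ≤ 4 := by nlinarith
        have hd0 : (0 : ℝ) ≤ d k := by positivity
        nlinarith
      linarith
  rw [show σ ^ 2 * A / 3200 = q / 40 by rw [hq]; ring]
  intro That hThat
  obtain ⟨ε, hε⟩ := exists_errorProb_of_covering (b := A / 80) (t := q / 40) hσ h0.le h1.le hThat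
    0 T (fun ε => by rw [sub_zero, hTsq]) (fun Y => by
      by_cases hex : ∃ ε₀, frobSq (Y - T ε₀) < q / 40
      · obtain ⟨ε₀, hε₀⟩ := hex
        calc ∑ ε, (if frobSq (Y - T ε) < q / 40 then (1 : ℝ) else 0)
            ≤ ∑ ε : (k : Fin m) → Fin (d k) → Bool,
                ∏ k, (if k ∈ K then (if 19 / 20 < |z ε₀ k (ε k)| then (1 : ℝ) else 0) else 1) := by
              refine Finset.sum_le_sum fun ε _ => ?_
              split_ifs with hlt
              · have h2 := frobSq_sub_le Y (T ε₀) (T ε)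
                rw [hdist] at h2
                have h3 : 19 / 20 < ∏ k, z ε₀ k (ε k) := by
                  by_contra! hcon
                  have := mul_le_mul_of_nonneg_left hcon hq0.le
                  linarith
                have h4 : ∀ k, 19 / 20 < |z ε₀ k (ε k)| := fun k => by
                  refine h3.trans_le ((le_abs_self _).trans ?_)
                  rw [Finset.abs_prod, ← Finset.mul_prod_erase _ _ (Finset.mem_univ k)]
                  exact mul_le_of_le_one_right (abs_nonneg _)
                    (Finset.prod_le_one (fun _ _ => abs_nonneg _) fun _ _ => hz1 _ _ _)
                simp [h4]
              · refine Finset.prod_nonneg fun k _ => ?_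
                split_ifs <;> norm_num
          _ = ∏ k, ∑ c, (if k ∈ K then (if 19 / 20 < |z ε₀ k c| then (1 : ℝ) else 0) else 1) := by
              rw [← Fintype.prod_sum fun k c =>
                (if k ∈ K then (if 19 / 20 < |z ε₀ k c| then (1 : ℝ) else 0) else 1)]
          _ ≤ ∏ k, (2 ^ d k * (if k ∈ K then Real.exp (-(d k * r k / 40 : ℝ)) else 1)) := by
              refine Finset.prod_le_prod (fun k _ => Finset.sum_nonneg fun c _ => ?_) fun k _ => ?_
              · split_ifs <;> norm_num
              · by_cases hk : k ∈ K
                · simp only [hk, if_true]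
                  exact hcount ε₀ k hk
                · simp [hk]
          _ = _ := by
              rw [Finset.prod_mul_distrib, Finset.prod_ite_mem, Finset.univ_inter, ← Real.exp_sum,
                mul_comm]
              congr 1
              · congr 1
                rw [Finset.sum_neg_distrib, ← Finset.sum_div, ← hA]
                ring
              · simp
      · push Not at hex
        rw [Finset.sum_eq_zero fun ε _ => if_neg (not_lt.mpr (hex ε))]
        positivity)
  refine ⟨T ε, hTm ε, _, le_trans (ENNReal.ofReal_le_ofReal ?_) hε⟩
  refine one_div_hundred_le.trans (sub_le_sub_left (Real.exp_le_exp.mpr ?_) 1)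
  linarith

end Signs

/-! ### Collecting the degrees of freedom -/

section Count

variable {m : ℕ} {d r : Fin m → ℕ}

/-- Modes of rank at least `2` contribute at most `2 r*` to `∑ r_k²`: for `k` different from the mode
`k₀` of largest rank, `r_k² ≤ r_k r_{k₀}`, and the other ranks multiply to a power of `2`. -/
lemma sum_sq_rank_le (hr : ∀ k, 1 ≤ r k) (hprod : ∀ k, r k ≤ ∏ j ∈ Finset.univ.erase k, r j)
    {k₀ : Fin m} (hmax : ∀ k, r k ≤ r k₀) :
    ∑ k ∈ Finset.univ.filter (fun k => 2 ≤ r k), r k ^ 2 ≤ 2 * ∏ k, r k := by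
  set S := Finset.univ.filter (fun k => 2 ≤ r k) with hS
  by_cases hk₀ : k₀ ∈ S
  · have hfirst : r k₀ ^ 2 ≤ ∏ k, r k := by
      rw [← Finset.mul_prod_erase _ _ (Finset.mem_univ k₀), sq]
      exact Nat.mul_le_mul_left _ (hprod k₀)
    have hone : ∀ k ∈ S.erase k₀, 2 ^ ((S.erase k₀).card - 1) * r k ^ 2 ≤ ∏ k, r k := by
      intro k hk
      calc 2 ^ ((S.erase k₀).card - 1) * r k ^ 2
          ≤ (∏ j ∈ (S.erase k₀).erase k, r j) * (r k * r k₀) := by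
            rw [← Finset.card_erase_of_mem hk, sq, ← Finset.prod_const]
            refine Nat.mul_le_mul (Finset.prod_le_prod' fun j hj => ?_)
              (Nat.mul_le_mul_left _ (hmax k))
            exact (Finset.mem_filter.mp (Finset.mem_of_mem_erase (Finset.mem_of_mem_erase hj))).2
        _ = ∏ j ∈ S, r j := by
            rw [← Finset.mul_prod_erase _ _ hk₀, ← Finset.mul_prod_erase _ _ hk]
            ring
        _ ≤ ∏ k, r k := Finset.prod_le_prod_of_subset_of_one_le' (Finset.subset_univ S)
            fun k _ _ => hr k
    have hrest : ∑ k ∈ S.erase k₀, r k ^ 2 ≤ ∏ k, r k := by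
      rcases (S.erase k₀).eq_empty_or_nonempty with he | hne
      · rw [he]; simp
      · have h1 : (S.erase k₀).card ≤ 2 ^ ((S.erase k₀).card - 1) := by
          have := Nat.lt_two_pow_self (n := (S.erase k₀).card - 1)
          have := hne.card_pos
          omega
        have h2 := Finset.sum_le_sum hone
        rw [← Finset.mul_sum, Finset.sum_const, smul_eq_mul] at h2
        exact Nat.le_of_mul_le_mul_left (h2.trans (Nat.mul_le_mul_right _ h1)) (by positivity)
    rw [← Finset.add_sum_erase _ _ hk₀]
    omega
  · have hempty : S = ∅ := by
      rw [Finset.eq_empty_iff_forall_notMem]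
      intro k hk
      rw [hS, Finset.mem_filter] at hk hk₀
      exact hk₀ ⟨Finset.mem_univ _, hk.2.trans (hmax k)⟩
    rw [hempty]
    simp

/-- The modes with `d_k < 2 r_k` are absorbed in the size of the core, since `d_k r_k ≤ 2 r_k²`. -/
lemma DoF_le (hd : ∀ k, 2 ≤ d k) (hr : ∀ k, 1 ≤ r k)
    (hprod : ∀ k, r k ≤ ∏ j ∈ Finset.univ.erase k, r j) {k₀ : Fin m} (hmax : ∀ k, r k ≤ r k₀) :
    DoF d r ≤ 5 * ∏ k, r k +
      ∑ k ∈ Finset.univ.filter (fun k => r k ≤ 2 ∧ 2 * r k ≤ d k), d k * r k +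
      ∑ k ∈ Finset.univ.filter (fun k => 3 ≤ r k ∧ 2 * r k ≤ d k), d k * r k := by
  have h1 := sum_sq_rank_le hr hprod hmax
  have h2 : ∑ k, d k * r k ≤ 2 * ∑ k ∈ Finset.univ.filter (fun k => 2 ≤ r k), r k ^ 2 +
      ∑ k ∈ Finset.univ.filter (fun k => r k ≤ 2 ∧ 2 * r k ≤ d k), d k * r k +
      ∑ k ∈ Finset.univ.filter (fun k => 3 ≤ r k ∧ 2 * r k ≤ d k), d k * r k := by
    rw [Finset.mul_sum, Finset.sum_filter, Finset.sum_filter, Finset.sum_filter,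
      ← Finset.sum_add_distrib, ← Finset.sum_add_distrib]
    refine Finset.sum_le_sum fun k _ => ?_
    have := hd k
    rcases le_or_gt (2 * r k) (d k) with h | h
    · rcases le_or_gt (r k) 2 with h' | h'
      · rw [if_pos (show r k ≤ 2 ∧ 2 * r k ≤ d k from ⟨h', h⟩)]
        omega
      · rw [if_pos (show 3 ≤ r k ∧ 2 * r k ≤ d k from ⟨h', h⟩)]
        omega
    · rw [if_pos (by omega : 2 ≤ r k)]
      have : d k * r k ≤ 2 * r k ^ 2 := by nlinarith
      omega
  unfold DoF
  omega

end Count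

lemma hasRisk_DoF {m : ℕ} {d r : Fin m → ℕ} {μ σ α : ℝ} (hm : 1 ≤ m) (hd : ∀ k, 2 ≤ d k)
    (hr : ∀ k, 1 ≤ r k) (hrd : ∀ k, r k ≤ d k)
    (hprod : ∀ k, r k ≤ ∏ j ∈ Finset.univ.erase k, r j) (hμ : 1 ≤ μ) (hσ : 0 < σ) (h0 : 0 < α)
    (h1 : α < 1) : HasRisk d r μ σ α (σ ^ 2 * (DoF d r : ℝ) / 3000000) := by
  have : Nonempty (Fin m) := ⟨⟨0, hm⟩⟩
  obtain ⟨k₀, -, hk₀⟩ := Finset.exists_max_image Finset.univ r Finset.univ_nonempty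
  have hmax : ∀ k, r k ≤ r k₀ := fun k => hk₀ k (Finset.mem_univ k)
  set K₁ := Finset.univ.filter fun k => r k ≤ 2 ∧ 2 * r k ≤ d k with hK₁
  set K₂ := Finset.univ.filter fun k => 3 ≤ r k ∧ 2 * r k ≤ d k with hK₂
  have hmem₂ : ∀ k ∈ K₂, 3 ≤ r k ∧ 2 * r k ≤ d k := fun k hk => (Finset.mem_filter.mp hk).2
  have hle : (DoF d r : ℝ) ≤ 5 * ∏ k, (r k : ℝ) + ∑ k ∈ K₁, (d k * r k : ℝ) +
      ∑ k ∈ K₂, (d k * r k : ℝ) := by exact_mod_cast DoF_le hd hr hprod hmax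
  have hcore := hasRisk_core (d := d) hμ hr hrd hσ h0 h1
  have hsign := hasRisk_signs hμ hr hrd hσ h0 h1 (K := K₁) fun k hk => (Finset.mem_filter.mp hk).2
  have hrest := hasRisk_factors_erase hμ hr hrd hσ h0 h1 hmax (K := K₂.erase k₀)
    (Finset.notMem_erase k₀ K₂) fun k hk => hmem₂ k (Finset.mem_of_mem_erase hk)
  have hsplit : ∃ x : ℝ, ∑ k ∈ K₂, (d k * r k : ℝ) ≤ x + ∑ k ∈ K₂.erase k₀, (d k * r k : ℝ) ∧
      HasRisk d r μ σ α (σ ^ 2 * x / 699840) := by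
    by_cases hk : k₀ ∈ K₂
    · exact ⟨_, (Finset.add_sum_erase K₂ (fun k => (d k * r k : ℝ)) hk).ge,
        hasRisk_factor hμ hr hrd hσ h0 h1 (hmem₂ k₀ hk) (hprod k₀)⟩
    · refine ⟨0, by rw [Finset.erase_eq_of_notMem hk, zero_add], hcore.mono ?_⟩
      rw [mul_zero, zero_div]
      positivity
  obtain ⟨x, hx, hxr⟩ := hsplit
  have hσ2 : 0 < σ ^ 2 := by positivity
  have hD : (0 : ℝ) ≤ DoF d r := by positivity
  -- one of the four contributions carries a quarter of the degrees of freedom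
  rcases le_or_gt (DoF d r : ℝ) (20 * ∏ k, (r k : ℝ)) with h | ha
  · exact hcore.mono (by nlinarith)
  rcases le_or_gt (DoF d r : ℝ) (4 * ∑ k ∈ K₁, (d k * r k : ℝ)) with h | hb
  · exact hsign.mono (by nlinarith)
  rcases le_or_gt (DoF d r : ℝ) (4 * x) with h | hc
  · exact hxr.mono (by nlinarith)
  · refine hrest.mono ?_
    have : (DoF d r : ℝ) ≤ 4 * ∑ k ∈ K₂.erase k₀, (d k * r k : ℝ) := by linarith
    nlinarith

end RobustTensor

end

theorem mainTheorem3 :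
    ∃ c C : ℝ, 0 < c ∧ 0 < C ∧
      ∀ (m : ℕ) (d r : Fin m → ℕ) (μ σ α : ℝ), 1 ≤ m →
        (∀ k, 2 ≤ d k) → (∀ k, 1 ≤ r k) → (∀ k, r k ≤ d k) →
        (∀ k, r k ≤ ∏ j ∈ Finset.univ.erase k, r j) →
        1 ≤ μ → 0 < σ → 0 < α → α < 1 →
        ENNReal.ofReal c ≤
          ⨅ (That : RobustTensor.Tensor d → RobustTensor.Tensor d) (_ : Measurable That),
            ⨆ T ∈ RobustTensor.incoherentTensors d r μ,
              ⨆ κ : RobustTensor.Idx d → RobustTensor.Corruption σ,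
                RobustTensor.errorProb σ α κ That T
                  (C * σ ^ 2 * max (RobustTensor.DoF d r : ℝ)
                    (α ^ 2 * (∏ k, (d k : ℝ)) / (μ ^ m * ∏ k, (r k : ℝ)))) := by
  refine ⟨1 / 100, 1 / 3000000, by norm_num, by norm_num, ?_⟩
  intro m d r μ σ α hm hd hr hrd hprod hμ hσ h0 h1
  have hrisk : RobustTensor.HasRisk d r μ σ α (1 / 3000000 * σ ^ 2 *
      max (RobustTensor.DoF d r : ℝ)
        (α ^ 2 * (∏ k, (d k : ℝ)) / (μ ^ m * ∏ k, (r k : ℝ)))) := by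
    rcases le_total (RobustTensor.DoF d r : ℝ)
      (α ^ 2 * (∏ k, (d k : ℝ)) / (μ ^ m * ∏ k, (r k : ℝ))) with h | h
    · rw [max_eq_right h]
      refine (RobustTensor.hasRisk_contamination hμ hr hrd hσ h0 h1).mono ?_
      have : 0 ≤ σ ^ 2 * (α ^ 2 * (∏ k, (d k : ℝ)) / (μ ^ m * ∏ k, (r k : ℝ))) := by positivity
      linarith
    · rw [max_eq_left h]
      refine (RobustTensor.hasRisk_DoF hm hd hr hrd hprod hμ hσ h0 h1).mono (le_of_eq ?_)
      ring
  refine le_iInf₂ fun That hThat => ?_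
  obtain ⟨T, hT, κ, hκ⟩ := hrisk That hThat
  exact hκ.trans (le_iSup₂_of_le T hT (le_iSup_of_le κ le_rfl))
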